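/- Let $\mathbb{K}$ be a field, let $A$ be a (unital, associative, not necessarily finite-dimensional) $\mathbb{K}$-algebra, let $G$ be a finite group acting on $A$ by $\mathbb{K}$-algebra automorphisms, written $a\mapsto g(a)$, and let $n\geq 2$. Write $A^e=A\otimes_{\mathbb K}A^{\mathrm{op}}$, and let $A\#G=A\otimes_{\mathbb K}\mathbb{K}G$ be the skew group algebra, with multiplication $(a\#g)(b\#h)=a\,g(b)\#gh$. For an $A$-$A$-bimodule $V$ on which $\mathbb K$ acts centrally, let $T_A(V)=A\oplus V\oplus (V\otimes_A V)\oplus\cdots$ be its tensor algebra. The $n$-preprojective algebra of $A$ is $$\Pi_n(A)=T_A\bigl(\mathrm{Ext}^{n-1}_{A^e}(A,A^e)\bigr),$$ where $A$ and $A^e$ are regarded as left $A^e$-modules, and $\mathrm{Ext}^{n-1}_{A^e}(A,A^e)$ is a right $A^e$-module through right multiplication on the second argument, hence an $A$-$A$-bimodule via $e\cdot(a\otimes b)=b\,e\,a$. The group $G$ acts on $A^e$ by $g(a\otimes b)=g(a)\otimes g(b)$. By functoriality of $\mathrm{Ext}$ with respect to the automorphisms $g$ of $A^e$, $A$ and $A^e$,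 it acts on $\mathrm{Ext}^{n-1}_{A^e}(A,A^e)$ (this is the action extending $g(\theta)(a)=g(\theta(g^{-1}(a)))$ on $\mathrm{Hom}_{A^e}(A,A^e)$), and $g(aeb)=g(a)g(e)g(b)$. Hence $G$ acts on $\Pi_n(A)$ by algebra automorphisms, through the given action on $A$ and $g(v_1\otimes\cdots\otimes v_r)=g(v_1)\otimes\cdots\otimes g(v_r)$. Then there is an isomorphism of $\mathbb{K}$-algebras $$\Pi_n(A)\#G\;\simeq\;\Pi_n(A\#G).$$ -/

import Mathlib

open CategoryTheory CategoryTheory.Abelian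
open scoped TensorProduct

/-! ## The tensor algebra of a bimodule

`T_A(V) = A ⊕ V ⊕ (V ⊗_A V) ⊕ ⋯` for a `K`-algebra `A` and an `A`-`A`-bimodule `V` on which `K`
acts centrally.  Like Mathlib's `TensorAlgebra`, it is built by generators and relations: it is the
`K`-algebra generated by the `K`-vector space `A × V`, subject to the relations saying that
`A → T_A(V)` is a ring homomorphism and that `V → T_A(V)` is a map of `A`-`A`-bimodules. -/

section TensorAlgebra

universe w u v

variable (K : Type w) (A : Type u) (V : Type v) [Field K] [Ring A] [Algebra K A]
  [AddCommGroup V] [Module K V] [Module A V] [Module Aᵐᵒᵖ V]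

/-- The defining relations of the tensor algebra of the `A`-`A`-bimodule `V`. -/
inductive BimoduleTensorAlgebra.Rel :
    TensorAlgebra K (A × V) → TensorAlgebra K (A × V) → Prop
  | one : Rel (TensorAlgebra.ι K ((1 : A), (0 : V))) 1
  | mul (a b : A) : Rel (TensorAlgebra.ι K (a * b, (0 : V)))
      (TensorAlgebra.ι K (a, (0 : V)) * TensorAlgebra.ι K (b, (0 : V)))
  | left (a : A) (v : V) : Rel (TensorAlgebra.ι K ((0 : A), a • v))
      (TensorAlgebra.ι K (a, (0 : V)) * TensorAlgebra.ι K ((0 : A), v))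
  | right (v : V) (a : A) : Rel (TensorAlgebra.ι K ((0 : A), MulOpposite.op a • v))
      (TensorAlgebra.ι K ((0 : A), v) * TensorAlgebra.ι K (a, (0 : V)))

/-- The tensor algebra `T_A(V)` of an `A`-`A`-bimodule `V`, as a `K`-algebra. -/
def BimoduleTensorAlgebra : Type (max w u v) :=
  RingQuot (BimoduleTensorAlgebra.Rel K A V)

namespace BimoduleTensorAlgebra

noncomputable instance : Ring (BimoduleTensorAlgebra K A V) :=
  inferInstanceAs (Ring (RingQuot (BimoduleTensorAlgebra.Rel K A V)))

noncomputable instance : Algebra K (BimoduleTensorAlgebra K A V) :=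
  inferInstanceAs (Algebra K (RingQuot (BimoduleTensorAlgebra.Rel K A V)))

/-- The quotient map onto `T_A(V)`. -/
noncomputable def mk : TensorAlgebra K (A × V) →ₐ[K] BimoduleTensorAlgebra K A V :=
  RingQuot.mkAlgHom K (BimoduleTensorAlgebra.Rel K A V)

/-- The structure map `A → T_A(V)`. -/
noncomputable def incl : A →ₐ[K] BimoduleTensorAlgebra K A V :=
  AlgHom.ofLinearMap
    ((mk K A V).toLinearMap ∘ₗ TensorAlgebra.ι K ∘ₗ LinearMap.inl K A V)
    (by
      have h := RingQuot.mkAlgHom_rel K (Rel.one (K := K) (A := A) (V := V))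
      rw [map_one] at h
      exact h)
    (fun a b => by
      have h := RingQuot.mkAlgHom_rel K (Rel.mul (K := K) (V := V) a b)
      rw [map_mul] at h
      exact h)

/-- The structure map `V → T_A(V)`. -/
noncomputable def ι : V →ₗ[K] BimoduleTensorAlgebra K A V :=
  (mk K A V).toLinearMap ∘ₗ TensorAlgebra.ι K ∘ₗ LinearMap.inr K A V

variable {K A V}

theorem ι_smul (a : A) (v : V) : ι K A V (a • v) = incl K A V a * ι K A V v := by
  have h := RingQuot.mkAlgHom_rel K (Rel.left (K := K) a v)
  rw [map_mul] at h
  exact h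

theorem ι_op_smul (v : V) (a : A) :
    ι K A V (MulOpposite.op a • v) = ι K A V v * incl K A V a := by
  have h := RingQuot.mkAlgHom_rel K (Rel.right (K := K) v a)
  rw [map_mul] at h
  exact h

variable {B : Type*} [Ring B] [Algebra K B]

/-- The universal property of `T_A(V)`: an algebra map `f : A → B` and a `K`-linear map
`φ : V → B` with `φ(av) = f(a)φ(v)` and `φ(va) = φ(v)f(a)` extend to `T_A(V) → B`. -/
noncomputable def lift (f : A →ₐ[K] B) (φ : V →ₗ[K] B)
    (hl : ∀ (a : A) (v : V), φ (a • v) = f a * φ v)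
    (hr : ∀ (v : V) (a : A), φ (MulOpposite.op a • v) = φ v * f a) :
    BimoduleTensorAlgebra K A V →ₐ[K] B :=
  RingQuot.liftAlgHom K ⟨TensorAlgebra.lift K (f.toLinearMap.coprod φ), by
    intro x y h
    cases h <;> simp [hl, hr]⟩

section lift

variable (f : A →ₐ[K] B) (φ : V →ₗ[K] B)
    (hl : ∀ (a : A) (v : V), φ (a • v) = f a * φ v)
    (hr : ∀ (v : V) (a : A), φ (MulOpposite.op a • v) = φ v * f a)

@[simp]
theorem lift_incl (a : A) : lift f φ hl hr (incl K A V a) = f a := by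
  refine (RingQuot.liftAlgHom_mkAlgHom_apply K _ _ _).trans ?_
  simp

@[simp]
theorem lift_ι (v : V) : lift f φ hl hr (ι K A V v) = φ v := by
  refine (RingQuot.liftAlgHom_mkAlgHom_apply K _ _ _).trans ?_
  simp

end lift

/-- Uniqueness in the universal property of `T_A(V)`. -/
theorem algHom_ext {p q : BimoduleTensorAlgebra K A V →ₐ[K] B}
    (h : ∀ a : A, p (incl K A V a) = q (incl K A V a))
    (h' : ∀ v : V, p (ι K A V v) = q (ι K A V v)) : p = q := by
  refine RingQuot.ringQuot_ext' K p q (TensorAlgebra.hom_ext (LinearMap.ext ?_))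
  rintro ⟨a, v⟩
  have e : ((a, v) : A × V) = (a, 0) + (0, v) := by simp
  rw [e, map_add, map_add]
  exact congrArg₂ (· + ·) (h a) (h' v)

end BimoduleTensorAlgebra

end TensorAlgebra

/-! ## `G`-compatible bimodules and the induced action on the tensor algebra -/

/-- An `A`-`A`-bimodule `V` with a linear action of `G` is `G`-compatible if
`g(av) = g(a)g(v)` and `g(va) = g(v)g(a)`, that is, `g(avb) = g(a)g(v)g(b)`. -/
class GCompatibleBimodule (G A V : Type*) [Group G] [Ring A] [MulSemiringAction G A]
    [AddCommGroup V] [Module A V] [Module Aᵐᵒᵖ V] [DistribMulAction G V] : Prop where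
  smul_smul' : ∀ (g : G) (a : A) (v : V), g • (a • v) = (g • a) • (g • v)
  smul_op_smul' : ∀ (g : G) (a : A) (v : V),
    g • (MulOpposite.op a • v) = MulOpposite.op (g • a) • (g • v)

namespace BimoduleTensorAlgebra

variable (K A V G : Type*) [Field K] [Ring A] [Algebra K A]
  [AddCommGroup V] [Module K V] [Module A V] [Module Aᵐᵒᵖ V] [IsScalarTower K A V]
  [Group G] [MulSemiringAction G A] [SMulCommClass G K A]
  [DistribMulAction G V] [GCompatibleBimodule G A V]

/-- The `K`-linear map `v ↦ g(v)` on a `G`-compatible bimodule. -/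
def actLin (g : G) : V →ₗ[K] V where
  toFun v := g • v
  map_add' := smul_add g
  map_smul' k v := by
    have e : ∀ x : V, k • x = (k • (1 : A)) • x := fun x => by rw [smul_assoc, one_smul]
    rw [e, GCompatibleBimodule.smul_smul', smul_comm g k (1 : A), smul_one, ← e]
    rfl

/-- The algebra endomorphism of `T_A(V)` given by
`g(v₁ ⊗ ⋯ ⊗ vₙ) = g(v₁) ⊗ ⋯ ⊗ g(vₙ)` and the given action on `A`. -/
noncomputable def act (g : G) : BimoduleTensorAlgebra K A V →ₐ[K] BimoduleTensorAlgebra K A V :=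
  lift ((incl K A V).comp (MulSemiringAction.toAlgHom K A g)) (ι K A V ∘ₗ actLin K A V G g)
    (fun a v => by
      simp [actLin, GCompatibleBimodule.smul_smul', ι_smul])
    (fun v a => by
      exact (congrArg (ι K A V) (GCompatibleBimodule.smul_op_smul' g a v)).trans (ι_op_smul _ _))

@[simp]
theorem act_incl (g : G) (a : A) : act K A V G g (incl K A V a) = incl K A V (g • a) :=
  lift_incl _ _ _ _ a

@[simp]
theorem act_ι (g : G) (v : V) : act K A V G g (ι K A V v) = ι K A V (g • v) :=
  lift_ι _ _ _ _ v

noncomputable instance : MulSemiringAction G (BimoduleTensorAlgebra K A V) where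
  smul g x := act K A V G g x
  one_smul x := by
    have : act K A V G 1 = AlgHom.id K _ := algHom_ext (by simp) (by simp)
    exact congrArg (fun p => p x) this
  mul_smul g h x := by
    have : act K A V G (g * h) = (act K A V G g).comp (act K A V G h) :=
      algHom_ext (by simp [mul_smul]) (by simp [mul_smul])
    exact congrArg (fun p => p x) this
  smul_zero g := map_zero (act K A V G g)
  smul_add g := map_add (act K A V G g)
  smul_one g := map_one (act K A V G g)
  smul_mul g := map_mul (act K A V G g)

instance : SMulCommClass G K (BimoduleTensorAlgebra K A V) where
  smul_comm g k x := map_smul (act K A V G g) k x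

end BimoduleTensorAlgebra

/-! ## `Ext` over the enveloping algebra -/

section Naturality

universe u u'

variable {R : Type u} [Ring R]

/-- Restriction of scalars along a ring homomorphism is exact. -/
theorem restrictScalars_map_exact' {S : Type u'} [Ring S] (f : R →+* S)
    (X : ShortComplex (ModuleCat.{u} S)) (h : X.Exact) :
    (X.map (ModuleCat.restrictScalars.{u} f)).Exact := by
  rw [ShortComplex.ShortExact.moduleCat_exact_iff_function_exact] at h ⊢
  exact h

instance restrictScalars_preservesFiniteLimits' (f : R →+* R) :
    Limits.PreservesFiniteLimits (ModuleCat.restrictScalars.{u} f) :=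
  (((Functor.exact_tfae (ModuleCat.restrictScalars.{u} f)).out 1 3 rfl rfl).mp
    (restrictScalars_map_exact' f)).1

instance restrictScalars_preservesFiniteColimits' (f : R →+* R) :
    Limits.PreservesFiniteColimits (ModuleCat.restrictScalars.{u} f) :=
  (((Functor.exact_tfae (ModuleCat.restrictScalars.{u} f)).out 1 3 rfl rfl).mp
    (restrictScalars_map_exact' f)).2

theorem ext_induction {P : ∀ {n : ℕ} {X Y : ModuleCat.{u} R}, Ext X Y n → Prop}
    (h₀ : ∀ {X Y : ModuleCat.{u} R} (f : X ⟶ Y), P (Ext.mk₀ f))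
    (h₁ : ∀ {n : ℕ} {Y : ModuleCat.{u} R} {S : ShortComplex (ModuleCat.{u} R)} (hS : S.ShortExact)
      (e : Ext S.X₁ Y n), P e → P (hS.extClass.comp e (add_comm 1 n)))
    {n : ℕ} {X Y : ModuleCat.{u} R} (e : Ext X Y n) : P e := by
  induction n generalizing X Y with
  | zero =>
    obtain ⟨f, rfl⟩ := (Ext.mk₀_bijective X Y).2 e
    exact h₀ f
  | succ n ih =>
    have hS := X.shortExact_projectiveShortComplex
    have : Projective X.projectiveShortComplex.X₂ :=
      (IsProjective.iff_projective _).1 inferInstance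
    obtain ⟨e', rfl⟩ := precomp_extClass_surjective_of_projective_X₂ Y hS n e
    exact h₁ hS e' (ih e')

theorem ext_step {X₁ X₁' X₃ X₃' Y Y' : ModuleCat.{u} R} {n : ℕ}
    {x : Ext X₃ X₁ 1} {x' : Ext X₃' X₁' 1} {e : Ext X₁ Y n} {e' : Ext X₁' Y' n}
    {t₁ : X₁ ⟶ X₁'} {t₃ : X₃ ⟶ X₃'} {t : Y ⟶ Y'}
    (nat : x.comp (Ext.mk₀ t₁) (add_zero 1) = (Ext.mk₀ t₃).comp x' (zero_add 1))
    (ih : e.comp (Ext.mk₀ t) (add_zero n) = (Ext.mk₀ t₁).comp e' (zero_add n)) :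
    (x.comp e (add_comm 1 n)).comp (Ext.mk₀ t) (add_zero (n + 1)) =
      (Ext.mk₀ t₃).comp (x'.comp e' (add_comm 1 n)) (zero_add (n + 1)) := by
  rw [Ext.comp_assoc_of_third_deg_zero, ih,
    ← Ext.comp_assoc _ _ _ (add_zero 1) (zero_add n) (by omega), nat,
    Ext.comp_assoc _ _ _ (zero_add 1) (add_comm 1 n) (by omega)]

theorem ext_map_id {F : ModuleCat.{u} R ⥤ ModuleCat.{u} R} [F.Additive]
    [Limits.PreservesFiniteLimits F] [Limits.PreservesFiniteColimits F]
    (τ : F ⟶ 𝟭 (ModuleCat.{u} R)) {n : ℕ} {X Y : ModuleCat.{u} R} (e : Ext X Y n) :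
    (e.mapExactFunctor F).comp (Ext.mk₀ (τ.app Y)) (add_zero n) =
      (Ext.mk₀ (τ.app X)).comp e (zero_add n) := by
  refine ext_induction (P := fun {n X Y} e =>
    (e.mapExactFunctor F).comp (Ext.mk₀ (τ.app Y)) (add_zero n) =
      (Ext.mk₀ (τ.app X)).comp e (zero_add n)) ?_ ?_ e
  · intro X Y f
    have := τ.naturality f
    rw [Ext.mapExactFunctor_mk₀, Ext.mk₀_comp_mk₀, this]
    exact (Ext.mk₀_comp_mk₀ _ _).symm
  · intro n Y S hS e ih
    have nat : (hS.extClass.mapExactFunctor F).comp (Ext.mk₀ (τ.app S.X₁)) (add_zero 1) =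
        (Ext.mk₀ (τ.app S.X₃)).comp hS.extClass (zero_add 1) :=
      (congrArg (fun x => Ext.comp x (Ext.mk₀ (τ.app S.X₁)) (add_zero 1))
        (Ext.mapExactFunctor_extClass F hS)).trans
      (ShortComplex.ShortExact.extClass_naturality (hS.map_of_exact F) hS
        { τ₁ := τ.app S.X₁, τ₂ := τ.app S.X₂, τ₃ := τ.app S.X₃
          comm₁₂ := (τ.naturality S.f).symm, comm₂₃ := (τ.naturality S.g).symm })
    rw [Ext.mapExactFunctor_comp]
    exact ext_step nat ih

theorem ext_map_comp {F F' H : ModuleCat.{u} R ⥤ ModuleCat.{u} R} [F.Additive] [F'.Additive]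
    [H.Additive]
    [Limits.PreservesFiniteLimits F] [Limits.PreservesFiniteColimits F]
    [Limits.PreservesFiniteLimits F'] [Limits.PreservesFiniteColimits F']
    [Limits.PreservesFiniteLimits H] [Limits.PreservesFiniteColimits H]
    (τ : H ⟶ F ⋙ F') {n : ℕ} {X Y : ModuleCat.{u} R} (e : Ext X Y n) :
    (e.mapExactFunctor H).comp (Ext.mk₀ (τ.app Y)) (add_zero n) =
      (Ext.mk₀ (τ.app X)).comp ((e.mapExactFunctor F).mapExactFunctor F') (zero_add n) := by
  refine ext_induction (P := fun {n X Y} e =>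
    (e.mapExactFunctor H).comp (Ext.mk₀ (τ.app Y)) (add_zero n) =
      (Ext.mk₀ (τ.app X)).comp ((e.mapExactFunctor F).mapExactFunctor F') (zero_add n)) ?_ ?_ e
  · intro X Y f
    have := τ.naturality f
    rw [Ext.mapExactFunctor_mk₀, Ext.mapExactFunctor_mk₀, Ext.mapExactFunctor_mk₀,
      Ext.mk₀_comp_mk₀, this]
    exact (Ext.mk₀_comp_mk₀ _ _).symm
  · intro n Y S hS e ih
    have nat : (hS.extClass.mapExactFunctor H).comp (Ext.mk₀ (τ.app S.X₁)) (add_zero 1) =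
        (Ext.mk₀ (τ.app S.X₃)).comp ((hS.extClass.mapExactFunctor F).mapExactFunctor F')
          (zero_add 1) :=
      ((congrArg (fun x => Ext.comp x (Ext.mk₀ (τ.app S.X₁)) (add_zero 1))
        (Ext.mapExactFunctor_extClass H hS)).trans
      (ShortComplex.ShortExact.extClass_naturality (hS.map_of_exact H)
        ((hS.map_of_exact F).map_of_exact F')
        { τ₁ := τ.app S.X₁, τ₂ := τ.app S.X₂, τ₃ := τ.app S.X₃
          comm₁₂ := (τ.naturality S.f).symm, comm₂₃ := (τ.naturality S.g).symm })).trans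
      (congrArg (fun x => Ext.comp (Ext.mk₀ (τ.app S.X₃)) x (zero_add 1))
        ((congrArg (Ext.mapExactFunctor F') (Ext.mapExactFunctor_extClass F hS)).trans
          (Ext.mapExactFunctor_extClass F' (hS.map_of_exact F))).symm)
    rw [Ext.mapExactFunctor_comp, Ext.mapExactFunctor_comp, Ext.mapExactFunctor_comp]
    exact ext_step nat ih

theorem ext_transport {F F' H : ModuleCat.{u} R ⥤ ModuleCat.{u} R} [F.Additive] [F'.Additive]
    [H.Additive]
    [Limits.PreservesFiniteLimits F] [Limits.PreservesFiniteColimits F]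
    [Limits.PreservesFiniteLimits F'] [Limits.PreservesFiniteColimits F']
    [Limits.PreservesFiniteLimits H] [Limits.PreservesFiniteColimits H]
    {n : ℕ} {X Y : ModuleCat.{u} R} {e : Ext X Y n}
    {τX : H.obj X ⟶ F'.obj (F.obj X)} {τY : H.obj Y ⟶ F'.obj (F.obj Y)}
    {i : X ⟶ F.obj X} {i' : X ⟶ F'.obj X} {j : X ⟶ H.obj X}
    {o : F.obj Y ⟶ Y} {o' : F'.obj Y ⟶ Y} {p : H.obj Y ⟶ Y}
    (h₁ : p = τY ≫ F'.map o ≫ o') (h₂ : j ≫ τX = i' ≫ F'.map i)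
    (h₃ : (e.mapExactFunctor H).comp (Ext.mk₀ τY) (add_zero n) =
      (Ext.mk₀ τX).comp ((e.mapExactFunctor F).mapExactFunctor F') (zero_add n)) :
    (Ext.mk₀ j).comp ((e.mapExactFunctor H).comp (Ext.mk₀ p) (add_zero n)) (zero_add n) =
      (Ext.mk₀ i').comp ((((Ext.mk₀ i).comp ((e.mapExactFunctor F).comp (Ext.mk₀ o) (add_zero n))
        (zero_add n)).mapExactFunctor F').comp (Ext.mk₀ o') (add_zero n)) (zero_add n) := by
  rw [h₁, Ext.mapExactFunctor_comp, Ext.mapExactFunctor_comp, Ext.mapExactFunctor_mk₀,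
    Ext.mapExactFunctor_mk₀, ← Ext.mk₀_comp_mk₀, ← Ext.mk₀_comp_mk₀,
    ← Ext.comp_assoc_of_third_deg_zero (e.mapExactFunctor H), h₃,
    Ext.comp_assoc_of_third_deg_zero, Ext.mk₀_comp_mk₀_assoc, h₂,
    Ext.comp_assoc_of_third_deg_zero, Ext.mk₀_comp_mk₀_assoc,
    Ext.comp_assoc_of_third_deg_zero]

end Naturality

section ExtBimodule

universe w u v

variable (K : Type w) (A : Type u) [Field K] [Ring A] [Algebra K A]

/-- The enveloping algebra `A^e = A ⊗_K A^op`. -/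
abbrev Env : Type u := A ⊗[K] Aᵐᵒᵖ

/-- `A` as a left `A^e`-module, `(a ⊗ b) x = a x b`. -/
noncomputable def envSelf : ModuleCat.{u} (Env K A) :=
  letI : Module (Env K A) A := TensorProduct.Algebra.module
  ModuleCat.of (Env K A) A

/-- `A^e` as a left module over itself. -/
noncomputable def envFree : ModuleCat.{u} (Env K A) := ModuleCat.of (Env K A) (Env K A)

/-- Right multiplication by `x`, as an endomorphism of the left module `A^e`. -/
noncomputable def envRight (x : Env K A) : envFree K A ⟶ envFree K A :=
  ModuleCat.ofHom (LinearMap.toSpanSingleton (Env K A) (Env K A) x)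

theorem envRight_comp (x y : Env K A) :
    envRight K A x ≫ envRight K A y = envRight K A (x * y) :=
  ModuleCat.hom_ext (LinearMap.ext fun z : Env K A => mul_assoc z x y)

theorem envRight_one : envRight K A 1 = 𝟙 (envFree K A) :=
  ModuleCat.hom_ext (LinearMap.ext fun z : Env K A => mul_one z)

theorem envRight_add (x y : Env K A) :
    envRight K A (x + y) = envRight K A x + envRight K A y :=
  ModuleCat.hom_ext (LinearMap.ext fun z : Env K A => mul_add z x y)

theorem envRight_zero : envRight K A 0 = 0 :=
  ModuleCat.hom_ext (LinearMap.ext fun z : Env K A => mul_zero z)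

/-- The group `Ext^m_{A^e}(A, A^e)`, where `A` and `A^e` are regarded as left `A^e`-modules. -/
def ExtEnv (m : ℕ) : Type u := Ext.{u} (envSelf K A) (envFree K A) m

noncomputable instance (m : ℕ) : AddCommGroup (ExtEnv K A m) :=
  inferInstanceAs (AddCommGroup (Ext.{u} (envSelf K A) (envFree K A) m))

namespace ExtEnv

variable {K A} {m : ℕ}

/-- The right action of `A^e` on `Ext^m_{A^e}(A, A^e)`, induced by right multiplication
on the second argument. -/
noncomputable def rmul (e : ExtEnv K A m) (x : Env K A) : ExtEnv K A m :=
  Ext.comp e (Ext.mk₀ (envRight K A x)) (add_zero m)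

theorem rmul_one (e : ExtEnv K A m) : e.rmul 1 = e := by
  unfold rmul; rw [envRight_one]; exact Ext.comp_mk₀_id _

theorem rmul_mul (e : ExtEnv K A m) (x y : Env K A) : (e.rmul x).rmul y = e.rmul (x * y) := by
  unfold rmul
  rw [← envRight_comp, ← Ext.mk₀_comp_mk₀]
  exact Ext.comp_assoc_of_third_deg_zero _ _ _ _

theorem rmul_add (e : ExtEnv K A m) (x y : Env K A) : e.rmul (x + y) = e.rmul x + e.rmul y := by
  unfold rmul
  rw [envRight_add, Ext.mk₀_add]
  exact Ext.comp_add _ _ _ _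

theorem rmul_zero (e : ExtEnv K A m) : e.rmul 0 = 0 := by
  unfold rmul
  rw [envRight_zero, Ext.mk₀_zero]
  exact Ext.comp_zero _ _ _ _ _

theorem add_rmul (e f : ExtEnv K A m) (x : Env K A) : (e + f).rmul x = e.rmul x + f.rmul x :=
  Ext.add_comp _ _ _ _

theorem zero_rmul (x : Env K A) : (0 : ExtEnv K A m).rmul x = 0 :=
  Ext.zero_comp _ _ _ _ _

end ExtEnv

open ExtEnv

/-- Right `A^e`-modules are `A`-`A`-bimodules through `e · (a ⊗ b) = b e a`.
This is the left action of `A`. -/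
noncomputable instance (m : ℕ) : Module A (ExtEnv K A m) where
  smul b e := e.rmul (1 ⊗ₜ MulOpposite.op b)
  one_smul e := rmul_one e
  mul_smul b b' e := by
    refine Eq.trans ?_ (rmul_mul e (1 ⊗ₜ MulOpposite.op b') (1 ⊗ₜ MulOpposite.op b)).symm
    rw [Algebra.TensorProduct.tmul_mul_tmul, one_mul, ← MulOpposite.op_mul]
    rfl
  smul_zero b := zero_rmul _
  smul_add b e f := add_rmul _ _ _
  add_smul b b' e := by
    refine Eq.trans ?_ (rmul_add e (1 ⊗ₜ MulOpposite.op b) (1 ⊗ₜ MulOpposite.op b'))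
    rw [← TensorProduct.tmul_add, ← MulOpposite.op_add]
    rfl
  zero_smul e := by
    refine Eq.trans ?_ (rmul_zero e)
    rw [← TensorProduct.tmul_zero (R := K) (N := Aᵐᵒᵖ) (1 : A), ← MulOpposite.op_zero]
    rfl

/-- The right action of `A` on `Ext^m_{A^e}(A, A^e)`. -/
noncomputable instance (m : ℕ) : Module Aᵐᵒᵖ (ExtEnv K A m) where
  smul a e := e.rmul (a.unop ⊗ₜ 1)
  one_smul e := rmul_one e
  mul_smul a a' e := by
    refine Eq.trans ?_ (rmul_mul e (a'.unop ⊗ₜ 1) (a.unop ⊗ₜ 1)).symm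
    rw [Algebra.TensorProduct.tmul_mul_tmul, one_mul, ← MulOpposite.unop_mul]
    rfl
  smul_zero a := zero_rmul _
  smul_add a e f := add_rmul _ _ _
  add_smul a a' e := by
    refine Eq.trans ?_ (rmul_add e (a.unop ⊗ₜ 1) (a'.unop ⊗ₜ 1))
    rw [← TensorProduct.add_tmul, ← MulOpposite.unop_add]
    rfl
  zero_smul e := by
    refine Eq.trans ?_ (rmul_zero e)
    rw [← TensorProduct.zero_tmul (R := K) A (1 : Aᵐᵒᵖ), ← MulOpposite.unop_zero]
    rfl

variable {K A} in
theorem ExtEnv.smul_def {m : ℕ} (a : A) (e : ExtEnv K A m) :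
    a • e = e.rmul (1 ⊗ₜ MulOpposite.op a) := rfl

variable {K A} in
theorem ExtEnv.op_smul_def {m : ℕ} (a : A) (e : ExtEnv K A m) :
    MulOpposite.op a • e = e.rmul (a ⊗ₜ 1) := rfl

instance (m : ℕ) : SMulCommClass A Aᵐᵒᵖ (ExtEnv K A m) where
  smul_comm a b e := by
    refine (rmul_mul e (b.unop ⊗ₜ 1) (1 ⊗ₜ MulOpposite.op a)).trans
      (Eq.trans ?_ (rmul_mul e (1 ⊗ₜ MulOpposite.op a) (b.unop ⊗ₜ 1)).symm)
    simp [Algebra.TensorProduct.tmul_mul_tmul]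

/-- The `K`-vector space structure on `Ext^m_{A^e}(A, A^e)`, through the left action of `A`. -/
noncomputable instance (m : ℕ) : Module K (ExtEnv K A m) :=
  Module.compHom _ (algebraMap K A)

instance (m : ℕ) : IsScalarTower K A (ExtEnv K A m) where
  smul_assoc k a e := by
    rw [Algebra.smul_def, mul_smul]
    rfl

/-- `K` acts centrally on `Ext^m_{A^e}(A, A^e)`. -/
instance (m : ℕ) : IsScalarTower K Aᵐᵒᵖ (ExtEnv K A m) where
  smul_assoc k a e := by
    have h : ∀ f : ExtEnv K A m, k • f = MulOpposite.op (algebraMap K A k) • f := fun f => by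
      change f.rmul (1 ⊗ₜ MulOpposite.op (algebraMap K A k)) = f.rmul (algebraMap K A k ⊗ₜ 1)
      congr 1
      rw [← MulOpposite.algebraMap_apply, Algebra.algebraMap_eq_smul_one,
        Algebra.algebraMap_eq_smul_one, TensorProduct.smul_tmul]
    rw [h, ← mul_smul, Algebra.smul_def]
    rfl

/-! ### The action of `G` -/

variable (G : Type v) [Group G] [MulSemiringAction G A] [SMulCommClass G K A]

/-- The automorphism `g(a ⊗ b) = g(a) ⊗ g(b)` of `A^e`. -/
noncomputable def envAct (g : G) : Env K A →ₐ[K] Env K A :=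
  Algebra.TensorProduct.map (MulSemiringAction.toAlgHom K A g)
    (AlgHom.op (MulSemiringAction.toAlgHom K A g))

@[simp]
theorem envAct_tmul (g : G) (a : A) (b : Aᵐᵒᵖ) :
    envAct K A G g (a ⊗ₜ b) = (g • a) ⊗ₜ MulOpposite.op (g • b.unop) := rfl

theorem envAct_one : envAct K A G 1 = AlgHom.id K _ := by
  ext x <;> simp

theorem envAct_mul (g h : G) :
    envAct K A G (g * h) = (envAct K A G g).comp (envAct K A G h) := by
  ext x <;> simp [mul_smul]

theorem envAct_act_inv (g : G) (x : Env K A) :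
    envAct K A G g (envAct K A G g⁻¹ x) = x := by
  rw [← AlgHom.comp_apply, ← envAct_mul, mul_inv_cancel, envAct_one]
  rfl

theorem envAct_inv_act (g : G) (x : Env K A) :
    envAct K A G g⁻¹ (envAct K A G g x) = x := by
  rw [← AlgHom.comp_apply, ← envAct_mul, inv_mul_cancel, envAct_one]
  rfl

/-- The twist of left `A^e`-modules by `g`: the module `M` with the new action
`x * m = g⁻¹(x) m`. -/
noncomputable abbrev twist (g : G) : ModuleCat.{u} (Env K A) ⥤ ModuleCat.{u} (Env K A) :=
  ModuleCat.restrictScalars (envAct K A G g⁻¹).toRingHom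


theorem smul_envSelf (g : G) (x : Env K A) (a : A) :
    letI : Module (Env K A) A := TensorProduct.Algebra.module
    g • (x • a) = envAct K A G g x • (g • a) := by
  let _ : Module (Env K A) A := TensorProduct.Algebra.module
  change g • (x • a) = envAct K A G g x • (g • a)
  induction x using TensorProduct.induction_on with
  | zero =>
    have h : ∀ b : A, (0 : Env K A) • b = 0 := fun b =>
      LinearMap.congr_fun
        (map_zero (TensorProduct.Algebra.moduleAux (R := K) (A := A) (B := Aᵐᵒᵖ) (M := A))) b
    refine (congrArg (g • ·) (h a)).trans ((smul_zero g).trans ?_)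
    exact ((congrArg (· • (g • a)) (map_zero (envAct K A G g))).trans (h _)).symm
  | tmul b c =>
    rw [envAct_tmul, TensorProduct.Algebra.smul_def, TensorProduct.Algebra.smul_def]
    change g • (b * (a * c.unop)) = (g • b) * ((g • a) * (g • c.unop))
    rw [smul_mul', smul_mul']
  | add x y hx hy => rw [add_smul, smul_add, hx, hy, map_add, add_smul]

/-- `A → A`, `a ↦ g⁻¹(a)`, as a morphism from `A` to its twist by `g`. -/
noncomputable def selfIn (g : G) : envSelf K A ⟶ (twist K A G g).obj (envSelf K A) :=
  ModuleCat.ofHom (X := envSelf K A) (Y := (twist K A G g).obj (envSelf K A))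
    { toFun := fun a => (g⁻¹ • (show A from a) : A)
      map_add' := fun a b => smul_add g⁻¹ (show A from a) (show A from b)
      map_smul' := fun x a => smul_envSelf K A G g⁻¹ x a }

/-- `A^e → A^e`, `x ↦ g(x)`, as a morphism from the twist of `A^e` by `g` to `A^e`. -/
noncomputable def freeOut (g : G) : (twist K A G g).obj (envFree K A) ⟶ envFree K A :=
  ModuleCat.ofHom (X := (twist K A G g).obj (envFree K A)) (Y := envFree K A)
    { toFun := fun x => envAct K A G g x
      map_add' := fun x y => map_add (envAct K A G g) x y
      map_smul' := fun y x => by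
        refine (map_mul (envAct K A G g) (envAct K A G g⁻¹ y) x).trans ?_
        rw [envAct_act_inv]
        rfl }

/-- The twist by `1` is the identity. -/
noncomputable def twistOne : twist K A G 1 ⟶ 𝟭 (ModuleCat.{u} (Env K A)) :=
  (ModuleCat.restrictScalarsId' _ (by
    rw [inv_one, envAct_one]
    rfl)).hom

/-- The twist by `gh` is the twist by `h` followed by the twist by `g`. -/
noncomputable def twistMul (g h : G) :
    twist K A G (g * h) ⟶ twist K A G h ⋙ twist K A G g :=
  (ModuleCat.restrictScalarsComp' (envAct K A G g⁻¹).toRingHom (envAct K A G h⁻¹).toRingHom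
    (envAct K A G (g * h)⁻¹).toRingHom (by
      rw [mul_inv_rev, envAct_mul]
      rfl)).hom

namespace ExtEnv

variable {K A G} {m : ℕ}

/-- The natural action of `g ∈ G` on `Ext^m_{A^e}(A, A^e)`: twist an extension class of `A` by
`A^e` by the automorphism `g` of `A^e`, and identify the twists of `A` and of `A^e` with `A` and
`A^e` through `g`.  For `m = 0` it is `g(θ)(a) = g(θ(g⁻¹(a)))`. -/
noncomputable def extAct (g : G) (e : Ext.{u} (envSelf K A) (envFree K A) m) :
    Ext.{u} (envSelf K A) (envFree K A) m :=
  (Ext.mk₀ (selfIn K A G g)).comp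
    ((e.mapExactFunctor (twist K A G g)).comp (Ext.mk₀ (freeOut K A G g)) (add_zero m))
    (zero_add m)

theorem extAct_add (g : G) (e f : Ext.{u} (envSelf K A) (envFree K A) m) :
    extAct g (e + f) = extAct g e + extAct g f := by
  unfold extAct
  rw [Ext.mapExactFunctor_add, Ext.add_comp, Ext.comp_add]

theorem extAct_zero (g : G) :
    extAct g (0 : Ext.{u} (envSelf K A) (envFree K A) m) = 0 := by
  unfold extAct
  rw [Ext.mapExactFunctor_zero, Ext.zero_comp, Ext.comp_zero]

theorem extAct_one (e : Ext.{u} (envSelf K A) (envFree K A) m) : extAct (1 : G) e = e := by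
  have h₁ : freeOut K A G 1 = (twistOne K A G).app (envFree K A) :=
    ModuleCat.hom_ext (LinearMap.ext fun x : Env K A => by
      change envAct K A G 1 x = x
      rw [envAct_one]
      rfl)
  have h₂ : selfIn K A G 1 ≫ (twistOne K A G).app (envSelf K A) = 𝟙 _ :=
    ModuleCat.hom_ext (LinearMap.ext fun x : A => by
      change (1 : G)⁻¹ • x = x
      rw [inv_one, one_smul])
  have h₃ := ext_map_id (twistOne K A G) e
  unfold extAct
  rw [h₁]
  refine (congrArg (fun x => (Ext.mk₀ (selfIn K A G 1)).comp x (zero_add m)) h₃).trans ?_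
  refine (Ext.mk₀_comp_mk₀_assoc _ _ _).trans ?_
  rw [h₂]
  exact Ext.mk₀_id_comp _

theorem extAct_mul (g h : G) (e : Ext.{u} (envSelf K A) (envFree K A) m) :
    extAct (g * h) e = extAct g (extAct h e) := by
  have h₁ : freeOut K A G (g * h) = (twistMul K A G g h).app (envFree K A) ≫
      (twist K A G g).map (freeOut K A G h) ≫ freeOut K A G g :=
    ModuleCat.hom_ext (LinearMap.ext fun x : Env K A => by
      change envAct K A G (g * h) x = envAct K A G g (envAct K A G h x)
      rw [envAct_mul]
      rfl)
  have h₂ : selfIn K A G (g * h) ≫ (twistMul K A G g h).app (envSelf K A) =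
      selfIn K A G g ≫ (twist K A G g).map (selfIn K A G h) :=
    ModuleCat.hom_ext (LinearMap.ext fun x : A => by
      change (g * h)⁻¹ • x = h⁻¹ • g⁻¹ • x
      rw [mul_inv_rev, mul_smul])
  have h₃ := ext_map_comp (twistMul K A G g h) e
  exact ext_transport h₁ h₂ h₃

theorem extAct_comp (g : G) (e : Ext.{u} (envSelf K A) (envFree K A) m) (x : Env K A) :
    extAct g (e.comp (Ext.mk₀ (envRight K A x)) (add_zero m)) =
      (extAct g e).comp (Ext.mk₀ (envRight K A (envAct K A G g x))) (add_zero m) := by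
  have h : (twist K A G g).map (envRight K A x) ≫ freeOut K A G g =
      freeOut K A G g ≫ envRight K A (envAct K A G g x) :=
    ModuleCat.hom_ext (LinearMap.ext fun z : Env K A => map_mul (envAct K A G g) z x)
  unfold extAct
  rw [Ext.mapExactFunctor_comp, Ext.mapExactFunctor_mk₀, Ext.comp_assoc_of_third_deg_zero,
    Ext.comp_assoc_of_third_deg_zero, Ext.comp_assoc_of_third_deg_zero,
    Ext.mk₀_comp_mk₀, Ext.mk₀_comp_mk₀, h]

/-- The natural action of `g ∈ G` on `Ext^m_{A^e}(A, A^e)`. -/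
noncomputable def act (g : G) (e : ExtEnv K A m) : ExtEnv K A m := extAct g e

theorem act_rmul (g : G) (e : ExtEnv K A m) (x : Env K A) :
    act g (e.rmul x) = (act g e).rmul (envAct K A G g x) := extAct_comp g e x

end ExtEnv

noncomputable instance (m : ℕ) : DistribMulAction G (ExtEnv K A m) where
  smul g e := act g e
  one_smul := extAct_one
  mul_smul := extAct_mul
  smul_zero := extAct_zero
  smul_add := extAct_add

instance (m : ℕ) : GCompatibleBimodule G A (ExtEnv K A m) where
  smul_smul' g a e := (act_rmul g e _).trans
    (congrArg ((act g e).rmul) (by simp))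
  smul_op_smul' g a e := (act_rmul g e _).trans
    (congrArg ((act g e).rmul) (by simp))

/-! ## The `n`-preprojective algebra -/

/-- The `n`-preprojective algebra `Π_n(A) = T_A(Ext^{n-1}_{A^e}(A, A^e))`, for `n ≥ 2`. -/
abbrev PreprojectiveAlgebra (n : ℕ) : Type (max w u) :=
  BimoduleTensorAlgebra K A (ExtEnv K A (n - 1))

end ExtBimodule

/-! Write B = A#G, V = Ext^m_{A^e}(A, A^e) and W = Ext^m_{B^e}(B, B^e). There are two halves: a
homological one, saying that W is the bimodule V ⊗ KG, and a formal one, saying that T_B(V ⊗ KG) is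
T_A(V)#G.

Homological half. The coefficient at 1 ⊗ 1 is a map of A^e-bimodules B^e → A^e, and the elements g ⊗
h provide dual bases for it (`envFrobenius`), so A^e → B^e is a Frobenius extension. Hence
restriction is exact and preserves projectives, and composition with this trace identifies
Hom_{B^e}(X, B^e) with Hom_{A^e}(X, A^e). Dimension shifting carries this over to Ext
(`bijective_bimap_mapExactFunctor`, `bijective_shapiro`). Over A^e, B is the direct sum of the g⁻¹A,
each a twist of A, so W is a sum of copies of V indexed by G.

The bimodule structure is controlled by a single map φ : W → V (`extTr`): restrict to A^e, pull back
to A ⊂ B, push forward along the trace. It is A-bilinear. The part of a class e on the summand g⁻¹A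
is, up to an invertible twist, φ(e g⁻¹) (`twist_extRes`). So e is determined by all φ(e g), and each
v in V is φ(e) for some e with φ(e g) = 0 for g ≠ 1. Finally φ(g e g⁻¹) = g φ(e) (`extTr_conj`),
because g⁻¹ ⊗ g acts on every B^e-module as a natural map to its twist. This is where the functorial
action on V meets conjugation in W.

Formal half. These properties (`IsInducedBimodule`) give a section s : V → W of φ with w = ∑ s(φ(w
g⁻¹)) g. The universal properties of tensor and skew group algebras then yield maps in both
directions, mutually inverse because they are so on generators (`skewEquiv`). -/

/-! ## `Ext` and exact functors -/

namespace CategoryTheory.Abelian.Ext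

universe w₁ w₂ w₃ v₁ v₂ v₃ u₁ u₂ u₃

variable {C : Type u₁} [Category.{v₁} C] [Abelian C] [HasExt.{w₁} C]
  {D : Type u₂} [Category.{v₂} D] [Abelian D] [HasExt.{w₂} D]
  {E : Type u₃} [Category.{v₃} E] [Abelian E] [HasExt.{w₃} E]

/-- In an abelian category with enough projectives, the `Ext`-groups are generated by morphisms
under composition with classes of short exact sequences. -/
theorem induction_of_enoughProjectives [EnoughProjectives C]
    {P : ∀ {n : ℕ} {X Y : C}, Ext X Y n → Prop}
    (h₀ : ∀ {X Y : C} (f : X ⟶ Y), P (Ext.mk₀ f))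
    (h₁ : ∀ {n : ℕ} {Y : C} {S : ShortComplex C} (hS : S.ShortExact)
      (e : Ext S.X₁ Y n), P e → P (hS.extClass.comp e (add_comm 1 n)))
    {n : ℕ} {X Y : C} (e : Ext X Y n) : P e := by
  induction n generalizing X Y with
  | zero =>
    obtain ⟨f, rfl⟩ := (Ext.mk₀_bijective X Y).2 e
    exact h₀ f
  | succ n ih =>
    let p : ProjectivePresentation X := Classical.arbitrary _
    let S := ShortComplex.mk _ _ (Limits.kernel.condition p.f)
    have hS : S.ShortExact := { exact := ShortComplex.exact_kernel p.f }
    have : Projective S.X₂ := p.projective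
    obtain ⟨e', rfl⟩ := Ext.contravariant_sequence_exact₃ hS _ e (Ext.eq_zero_of_projective _)
      (add_comm 1 n)
    exact h₁ hS e' (ih e')

/-- The bifunctoriality of `Ext`: composition with morphisms on both sides. -/
noncomputable def bimap {X X' Y Y' : C} {n : ℕ} (f : X' ⟶ X) (e : Ext X Y n) (g : Y ⟶ Y') :
    Ext X' Y' n :=
  (Ext.mk₀ f).comp (e.comp (Ext.mk₀ g) (add_zero n)) (zero_add n)

section bimap

variable {X X' X'' Y Y' Y'' : C} {n : ℕ}

theorem bimap_bimap (f' : X'' ⟶ X') (f : X' ⟶ X) (e : Ext X Y n) (g : Y ⟶ Y') (g' : Y' ⟶ Y'') :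
    bimap f' (bimap f e g) g' = bimap (f' ≫ f) e (g ≫ g') := by
  unfold bimap
  rw [Ext.comp_assoc_of_third_deg_zero, Ext.mk₀_comp_mk₀_assoc,
    Ext.comp_assoc_of_third_deg_zero, Ext.mk₀_comp_mk₀]

theorem bimap_id (e : Ext X Y n) : bimap (𝟙 X) e (𝟙 Y) = e := by
  unfold bimap
  rw [Ext.comp_mk₀_id, Ext.mk₀_id_comp]

theorem bimap_id_left (e : Ext X Y n) (g : Y ⟶ Y') :
    bimap (𝟙 X) e g = e.comp (Ext.mk₀ g) (add_zero n) :=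
  Ext.mk₀_id_comp _

theorem bimap_add (f : X' ⟶ X) (e e' : Ext X Y n) (g : Y ⟶ Y') :
    bimap f (e + e') g = bimap f e g + bimap f e' g := by
  unfold bimap
  rw [Ext.add_comp, Ext.comp_add]

theorem bimap_zero (f : X' ⟶ X) (g : Y ⟶ Y') : bimap f (0 : Ext X Y n) g = 0 := by
  unfold bimap
  rw [Ext.zero_comp, Ext.comp_zero]

theorem zero_bimap (e : Ext X Y n) (g : Y ⟶ Y') : bimap (0 : X' ⟶ X) e g = 0 := by
  unfold bimap
  rw [Ext.mk₀_zero, Ext.zero_comp]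

theorem sum_bimap {ι : Type*} [Fintype ι] (f : ι → (X' ⟶ X)) (e : Ext X Y n) (g : Y ⟶ Y') :
    bimap (∑ i, f i) e g = ∑ i, bimap (f i) e g := by
  unfold bimap
  rw [Ext.mk₀_sum, Ext.sum_comp]

theorem mapExactFunctor_bimap (F : C ⥤ D) [F.Additive] [Limits.PreservesFiniteLimits F]
    [Limits.PreservesFiniteColimits F] (f : X' ⟶ X) (e : Ext X Y n) (g : Y ⟶ Y') :
    (bimap f e g).mapExactFunctor F = bimap (F.map f) (e.mapExactFunctor F) (F.map g) := by
  unfold bimap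
  rw [Ext.mapExactFunctor_comp, Ext.mapExactFunctor_comp, Ext.mapExactFunctor_mk₀,
    Ext.mapExactFunctor_mk₀]

end bimap

/-- The maps on `Ext` induced by exact functors are natural in the functor. -/
theorem mapExactFunctor_comp_app [EnoughProjectives C] {F F' : C ⥤ D} [F.Additive] [F'.Additive]
    [Limits.PreservesFiniteLimits F] [Limits.PreservesFiniteColimits F]
    [Limits.PreservesFiniteLimits F'] [Limits.PreservesFiniteColimits F']
    (τ : F ⟶ F') {n : ℕ} {X Y : C} (e : Ext X Y n) :
    (e.mapExactFunctor F).comp (Ext.mk₀ (τ.app Y)) (add_zero n) =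
      (Ext.mk₀ (τ.app X)).comp (e.mapExactFunctor F') (zero_add n) := by
  refine induction_of_enoughProjectives (P := fun {n X Y} e =>
    (e.mapExactFunctor F).comp (Ext.mk₀ (τ.app Y)) (add_zero n) =
      (Ext.mk₀ (τ.app X)).comp (e.mapExactFunctor F') (zero_add n)) ?_ ?_ e
  · intro X Y f
    rw [Ext.mapExactFunctor_mk₀, Ext.mapExactFunctor_mk₀, Ext.mk₀_comp_mk₀, τ.naturality f,
      Ext.mk₀_comp_mk₀]
  · intro n Y S hS e ih
    -- The components of τ form a morphism from the F-image to the F'-image of the short exact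
    -- sequence, and extension classes are natural for such morphisms.
    have nat : (hS.extClass.mapExactFunctor F).comp (Ext.mk₀ (τ.app S.X₁)) (add_zero 1) =
        (Ext.mk₀ (τ.app S.X₃)).comp (hS.extClass.mapExactFunctor F') (zero_add 1) := by
      rw [Ext.mapExactFunctor_extClass, Ext.mapExactFunctor_extClass]
      exact ShortComplex.ShortExact.extClass_naturality (hS.map_of_exact F) (hS.map_of_exact F')
        { τ₁ := τ.app S.X₁, τ₂ := τ.app S.X₂, τ₃ := τ.app S.X₃
          comm₁₂ := (τ.naturality S.f).symm, comm₂₃ := (τ.naturality S.g).symm }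
    rw [Ext.mapExactFunctor_comp, Ext.mapExactFunctor_comp, Ext.comp_assoc_of_third_deg_zero, ih,
      ← Ext.comp_assoc _ _ _ (add_zero 1) (zero_add n) (by omega), nat,
      Ext.comp_assoc _ _ _ (zero_add 1) (add_comm 1 n) (by omega)]

/-- Naturality in the functor, in the form used below: a natural transformation can be slid past the
class from the second argument to the first. -/
theorem bimap_mapExactFunctor_app [EnoughProjectives C] {F F' : C ⥤ D} [F.Additive] [F'.Additive]
    [Limits.PreservesFiniteLimits F] [Limits.PreservesFiniteColimits F]
    [Limits.PreservesFiniteLimits F'] [Limits.PreservesFiniteColimits F']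
    (τ : F ⟶ F') {n : ℕ} {X Y : C} (e : Ext X Y n) {X' Y' : D} (f : X' ⟶ F.obj X)
    (g : F'.obj Y ⟶ Y') :
    bimap f (e.mapExactFunctor F) (τ.app Y ≫ g) = bimap (f ≫ τ.app X) (e.mapExactFunctor F') g := by
  have h := congrArg (fun x => bimap f x g) (mapExactFunctor_comp_app τ e)
  have h₁ : (e.mapExactFunctor F).comp (Ext.mk₀ (τ.app Y)) (add_zero n) =
      bimap (𝟙 _) (e.mapExactFunctor F) (τ.app Y) := (Ext.mk₀_id_comp _).symm
  have h₂ : (Ext.mk₀ (τ.app X)).comp (e.mapExactFunctor F') (zero_add n) =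
      bimap (τ.app X) (e.mapExactFunctor F') (𝟙 _) := by
    unfold bimap
    rw [Ext.comp_mk₀_id]
  simpa only [h₁, h₂, bimap_bimap, Category.comp_id, Category.id_comp] using h

/-- The map on `Ext` induced by a composition of exact functors. -/
theorem mapExactFunctor_functor_comp [EnoughProjectives C] (F : C ⥤ D) (F' : D ⥤ E) [F.Additive]
    [F'.Additive] [Limits.PreservesFiniteLimits F] [Limits.PreservesFiniteColimits F]
    [Limits.PreservesFiniteLimits F'] [Limits.PreservesFiniteColimits F']
    [Limits.PreservesFiniteLimits (F ⋙ F')] [Limits.PreservesFiniteColimits (F ⋙ F')]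
    {n : ℕ} {X Y : C} (e : Ext X Y n) :
    e.mapExactFunctor (F ⋙ F') = (e.mapExactFunctor F).mapExactFunctor F' := by
  refine induction_of_enoughProjectives (P := fun {n X Y} e =>
    e.mapExactFunctor (F ⋙ F') = (e.mapExactFunctor F).mapExactFunctor F') ?_ ?_ e
  · intro X Y f
    rw [Ext.mapExactFunctor_mk₀, Ext.mapExactFunctor_mk₀, Ext.mapExactFunctor_mk₀]
    rfl
  · intro n Y S hS e ih
    have h : hS.extClass.mapExactFunctor (F ⋙ F') =
        (hS.extClass.mapExactFunctor F).mapExactFunctor F' := by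
      rw [Ext.mapExactFunctor_extClass, Ext.mapExactFunctor_extClass]
      exact (Ext.mapExactFunctor_extClass F' (hS.map_of_exact F)).symm
    rw [Ext.mapExactFunctor_comp, Ext.mapExactFunctor_comp, Ext.mapExactFunctor_comp, ih, h]

attribute [local instance] Ext.subsingleton_of_projective in
/-- **Shapiro's lemma.** Let `F` be an exact functor preserving projective objects, and
`q : F(Y) ⟶ N` a morphism such that `θ ↦ F(θ) ≫ q` is a bijection from `Hom(X, Y)` to
`Hom(F(X), N)` for all `X`. Then the same formula defines a bijection on the `Ext`-groups. -/
theorem bijective_bimap_mapExactFunctor [EnoughProjectives C] (F : C ⥤ D) [F.Additive]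
    [Limits.PreservesFiniteLimits F] [Limits.PreservesFiniteColimits F]
    [F.PreservesProjectiveObjects] {Y : C} {N : D} (q : F.obj Y ⟶ N)
    (hq : ∀ X : C, Function.Bijective (fun θ : X ⟶ Y => F.map θ ≫ q)) (X : C) (n : ℕ) :
    Function.Bijective (fun e : Ext X Y n => bimap (𝟙 _) (e.mapExactFunctor F) q) := by
  let Φ (X : C) (n : ℕ) : Ext X Y n →+ Ext (F.obj X) N n :=
    { toFun := fun e => bimap (𝟙 _) (e.mapExactFunctor F) q
      map_zero' := by rw [Ext.mapExactFunctor_zero, bimap_zero]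
      map_add' := fun e e' => by rw [Ext.mapExactFunctor_add, bimap_add] }
  suffices h : ∀ X, Function.Bijective (Φ X n) from h X
  induction n with
  | zero =>
    intro X
    have h : ⇑(Φ X 0) ∘ Ext.mk₀ = Ext.mk₀ ∘ fun θ : X ⟶ Y => F.map θ ≫ q := by
      funext θ
      change bimap (𝟙 _) ((Ext.mk₀ θ).mapExactFunctor F) q = _
      rw [bimap_id_left, Ext.mapExactFunctor_mk₀, Ext.mk₀_comp_mk₀]
      rfl
    have h' := (Ext.mk₀_bijective (F.obj X) N).comp (hq X)
    rw [← h] at h'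
    exact (Function.Bijective.of_comp_iff _ (Ext.mk₀_bijective X Y)).1 h'
  | succ n hn =>
    intro X
    let P : ProjectivePresentation X := Classical.arbitrary _
    let S := ShortComplex.mk _ _ (Limits.kernel.condition P.f)
    have : Projective S.X₂ := P.projective
    have : Projective (S.map F).X₂ := Functor.PreservesProjectiveObjects.projective_obj P.projective
    have hS : S.ShortExact := { exact := ShortComplex.exact_kernel P.f }
    have hSF := hS.map_of_exact F
    -- Dimension shifting: both rows Extⁿ(X₂) → Extⁿ(X₁) → Extⁿ⁺¹(X₃) → 0 are exact, since `S.X₂`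
    -- and its image under `F` are projective. The case n handles the first two columns.
    exact AddMonoidHom.bijective_of_surjective_of_bijective_of_right_exact _ _ _ _
      (Φ S.X₂ n) (Φ S.X₁ n) (Φ S.X₃ (n + 1))
      (by
        ext e
        change (Ext.mk₀ (F.map S.f)).comp (bimap (𝟙 _) (e.mapExactFunctor F) q) (zero_add n) =
          bimap (𝟙 _) (((Ext.mk₀ S.f).comp e (zero_add n)).mapExactFunctor F) q
        rw [bimap_id_left, bimap_id_left, Ext.mapExactFunctor_comp, Ext.mapExactFunctor_mk₀,
          Ext.comp_assoc_of_third_deg_zero])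
      (by
        ext e
        change hSF.extClass.comp (bimap (𝟙 (F.obj S.X₁)) (e.mapExactFunctor F) q) (add_comm 1 n) =
          bimap (𝟙 _) ((hS.extClass.comp e (add_comm 1 n)).mapExactFunctor F) q
        refine (congrArg (fun x => Ext.comp hSF.extClass x (add_comm 1 n))
          (bimap_id_left (X := F.obj S.X₁) (e.mapExactFunctor F) q)).trans ?_
        rw [bimap_id_left, Ext.mapExactFunctor_comp, Ext.mapExactFunctor_extClass]
        exact (Ext.comp_assoc_of_third_deg_zero _ _ _ _).symm)
      ((ShortComplex.ab_exact_iff_function_exact _).1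
        (Ext.contravariant_sequence_exact₁' hS Y n (n + 1) (add_comm 1 n)))
      ((ShortComplex.ab_exact_iff_function_exact _).1
        (Ext.contravariant_sequence_exact₁' hSF N n (n + 1) (add_comm 1 n)))
      (hn _).surjective (hn _)
      (fun x₃ ↦ Ext.contravariant_sequence_exact₃ hS _ x₃ (by subsingleton) (add_comm 1 n))
      (fun y₃ ↦ Ext.contravariant_sequence_exact₃ hSF _ y₃ (by subsingleton) (add_comm 1 n))

end CategoryTheory.Abelian.Ext

/-! ## Shapiro's lemma for Frobenius extensions -/

section RestrictScalars

universe v u₁ u₂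

variable {R : Type u₁} {S : Type u₂} [Ring R] [Ring S] (f : R →+* S)

theorem restrictScalars_exact (X : ShortComplex (ModuleCat.{v} S)) (h : X.Exact) :
    (X.map (ModuleCat.restrictScalars.{v} f)).Exact := by
  rw [ShortComplex.ShortExact.moduleCat_exact_iff_function_exact] at h ⊢
  exact h

instance restrictScalars_finiteLimits :
    Limits.PreservesFiniteLimits (ModuleCat.restrictScalars.{v} f) :=
  (((Functor.exact_tfae (ModuleCat.restrictScalars.{v} f)).out 1 3 rfl rfl).mp
    (restrictScalars_exact f)).1

instance restrictScalars_finiteColimits :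
    Limits.PreservesFiniteColimits (ModuleCat.restrictScalars.{v} f) :=
  (((Functor.exact_tfae (ModuleCat.restrictScalars.{v} f)).out 1 3 rfl rfl).mp
    (restrictScalars_exact f)).2

end RestrictScalars

/-- A Frobenius system for a ring homomorphism `f : R → S`: a map of `R`-`R`-bimodules `S → R`
together with dual bases. -/
structure FrobeniusSystem {R S : Type*} [Ring R] [Ring S] (f : R →+* S) (ι : Type*)
    [Fintype ι] where
  /-- The Frobenius homomorphism. -/
  tr : S →+ R
  tr_left : ∀ r s, tr (f r * s) = r * tr s
  tr_right : ∀ s r, tr (s * f r) = tr s * r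
  /-- The first dual basis. -/
  x : ι → S
  /-- The second dual basis. -/
  y : ι → S
  sum_left : ∀ s, ∑ i, f (tr (s * x i)) * y i = s
  sum_right : ∀ s, ∑ i, x i * f (tr (y i * s)) = s

namespace FrobeniusSystem

universe w u

variable {R : Type u} {S : Type w} [Ring R] [Ring S] {f : R →+* S} {ι : Type*} [Fintype ι]
  (F : FrobeniusSystem f ι)

-- The dual bases make S a direct summand of a finite free R-module, so every summand of a free
-- S-module is projective over R.
include F in
theorem projective_restrictScalars [Small.{w} R] :
    (ModuleCat.restrictScalars.{w} f).PreservesProjectiveObjects where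
  projective_obj {X} hX := by
    have hX' : Module.Projective S X := ModuleCat.projective_of_module_projective X
    obtain ⟨s, hs⟩ := hX'.out
    let _ : Module R S := Module.compHom S f
    let _ : Module R X := Module.compHom X f
    have hS : Module.Projective R S := by
      -- The coordinates of z are tr(z xᵢ); `sum_left` says that the yᵢ recover z from them.
      refine Module.Projective.of_split (M := ι → R)
        (i := { toFun := fun z i => F.tr (z * F.x i)
                map_add' := fun a b => by ext; simp [add_mul]
                map_smul' := fun r z => by
                  ext j
                  change F.tr (f r * z * F.x j) = r * F.tr (z * F.x j)
                  rw [mul_assoc, F.tr_left] })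
        (s := { toFun := fun c => ∑ i, f (c i) * F.y i
                map_add' := fun a b => by simp [add_mul, Finset.sum_add_distrib]
                map_smul' := fun r c => by
                  change ∑ i, f (r * c i) * F.y i = f r * ∑ i, f (c i) * F.y i
                  simp [Finset.mul_sum, mul_assoc] }) ?_
      ext z
      exact F.sum_left z
    have hXS : Module.Projective R (X →₀ S) := by
      classical
      exact Module.Projective.of_equiv' (finsuppLequivDFinsupp R).symm
    have h : Module.Projective R X := by
      refine Module.Projective.of_split (M := X →₀ S)
        (i := { toFun := s
                map_add' := map_add s
                map_smul' := fun r z => by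
                  refine (map_smul s (f r) z).trans ?_
                  ext t
                  rfl })
        (s := { toFun := Finsupp.linearCombination S id
                map_add' := map_add _
                map_smul' := fun r z => by
                  refine Eq.trans ?_ (map_smul (Finsupp.linearCombination S id) (f r) z)
                  rfl }) ?_
      ext z
      exact hs z
    exact (IsProjective.iff_projective (R := R) X).1 h

section

-- N is a copy of the regular module in the universe of S, which may be larger than that of R.
variable {N : ModuleCat.{w} R} (e : R ≃ₗ[R] N)

/-- The Frobenius homomorphism as a morphism of `R`-modules. -/
noncomputable def trHom :
    (ModuleCat.restrictScalars.{w} f).obj (ModuleCat.of S S) ⟶ N :=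
  ModuleCat.ofHom (X := (ModuleCat.restrictScalars.{w} f).obj (ModuleCat.of S S)) (Y := N)
    { toFun := fun z : S => e (F.tr z)
      map_add' := fun a b : S =>
        (congrArg e (map_add F.tr a b)).trans (map_add e (F.tr a) (F.tr b))
      map_smul' := fun r (a : S) => by
        change e (F.tr (f r * a)) = r • e (F.tr a)
        rw [F.tr_left, ← smul_eq_mul, map_smul] }

/-- The `S`-linear map `X → S` coinduced from an `R`-linear map `X → R`. -/
def coinduced {X : Type*} [AddCommGroup X] [Module S X] (φ : X →+ R)
    (hφ : ∀ r x, φ (f r • x) = r * φ x) : X →ₗ[S] S where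
  toFun x := ∑ i, F.x i * f (φ (F.y i • x))
  map_add' a b := by simp [mul_add, Finset.sum_add_distrib]
  map_smul' z a := by
    -- Expand yᵢ z in the second dual basis by `sum_left`. After exchanging the sums, `sum_right`
    -- collapses the sum over i to z xⱼ.
    have h : ∀ i, φ (F.y i • z • a) = ∑ j, F.tr (F.y i * z * F.x j) * φ (F.y j • a) := by
      intro i
      rw [← mul_smul, ← F.sum_left (F.y i * z), Finset.sum_smul, map_sum]
      refine Finset.sum_congr rfl fun j _ => ?_
      rw [F.sum_left, mul_smul, hφ]
    simp_rw [h, map_sum, map_mul, Finset.mul_sum, RingHom.id_apply, smul_eq_mul, Finset.mul_sum]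
    rw [Finset.sum_comm]
    refine Finset.sum_congr rfl fun j _ => ?_
    simp_rw [← mul_assoc]
    rw [← Finset.sum_mul]
    congr 1
    simp_rw [mul_assoc (F.y _)]
    exact F.sum_right _

/-- By bilinearity the left side is ∑ tr(xᵢ) φ(yᵢ a) = φ(∑ f(tr xᵢ) yᵢ a), and the inner sum is a by
`sum_left` at 1. -/
theorem tr_coinduced {X : Type*} [AddCommGroup X] [Module S X] (φ : X →+ R)
    (hφ : ∀ r x, φ (f r • x) = r * φ x) (a : X) : F.tr (F.coinduced φ hφ a) = φ a := by
  change F.tr (∑ i, F.x i * f (φ (F.y i • a))) = φ a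
  have h := congrArg (fun z => φ (z • a)) (F.sum_left 1)
  simp only [one_mul, one_smul, Finset.sum_smul, map_sum, mul_smul, hφ] at h
  rw [← h, map_sum]
  exact Finset.sum_congr rfl fun i _ => F.tr_right _ _

/-- Injectivity: by `sum_right`, z is determined by the tr(yᵢ z), so by linearity θ is determined by
tr ∘ θ. Surjectivity: the coinduced map is a preimage. -/
theorem bijective_trHom (X : ModuleCat.{w} S) :
    Function.Bijective (fun θ : X ⟶ ModuleCat.of S S =>
      (ModuleCat.restrictScalars.{w} f).map θ ≫ F.trHom e) := by
  constructor
  · intro θ θ' h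
    have h' : ∀ x : X, F.tr (θ.hom x) = F.tr (θ'.hom x) := fun x =>
      e.injective (congrArg (fun k => k.hom x) h)
    refine ModuleCat.hom_ext (LinearMap.ext fun x => ?_)
    have hr : ∀ z z' : S, (∀ i, F.tr (F.y i * z) = F.tr (F.y i * z')) → z = z' := by
      intro z z' hz
      rw [← F.sum_right z, ← F.sum_right z']
      simp_rw [hz]
    refine hr _ _ fun i => ?_
    have := h' (F.y i • x)
    rwa [map_smul θ.hom, map_smul θ'.hom] at this
  · intro φ
    let φ' : X →+ R := e.symm.toAddEquiv.toAddMonoidHom.comp φ.hom.toAddMonoidHom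
    have hφ' : ∀ (r : R) (x : X), φ' (f r • x) = r * φ' x := fun r x => by
      have h₁ : φ.hom (f r • x : X) = r • φ.hom x := φ.hom.map_smul r x
      change e.symm (φ.hom (f r • x : X)) = r * e.symm (φ.hom x)
      rw [h₁, map_smul]
      rfl
    refine ⟨ModuleCat.ofHom (F.coinduced φ' hφ'), ModuleCat.hom_ext (LinearMap.ext fun x : X => ?_)⟩
    exact (congrArg e (F.tr_coinduced φ' hφ' x)).trans (e.apply_symm_apply _)

/-- **Shapiro's lemma** for a Frobenius extension `R → S`:
`Ext_S(X, S) ≃ Ext_R(X, R)`. -/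
theorem bijective_ext [Small.{w} R] (X : ModuleCat.{w} S) (n : ℕ) :
    Function.Bijective (fun z : Ext.{w} X (ModuleCat.of S S) n =>
      Ext.bimap (𝟙 _) (z.mapExactFunctor (ModuleCat.restrictScalars.{w} f)) (F.trHom e)) := by
  have := F.projective_restrictScalars
  exact Ext.bijective_bimap_mapExactFunctor _ _ (F.bijective_trHom e) X n

end

end FrobeniusSystem

/-! ### Twists realised by multiplication with a semilinear element -/

section SemilinearMultiplication

universe w u₁ u₂

variable {R : Type u₁} {S : Type u₂} [Ring R] [Ring S]

/-- If `s f(r) = f(α(r)) s`, multiplication by `s` is a natural map of `R`-modules from an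
`S`-module to its twist by `α`. -/
noncomputable def smulNatTrans (f : R →+* S) (α : R →+* R) (s : S)
    (hs : ∀ r, s * f r = f (α r) * s) :
    ModuleCat.restrictScalars.{w} f ⟶
      ModuleCat.restrictScalars.{w} f ⋙ ModuleCat.restrictScalars.{w} α where
  app M := ModuleCat.ofHom (X := (ModuleCat.restrictScalars.{w} f).obj M)
    (Y := (ModuleCat.restrictScalars.{w} α).obj ((ModuleCat.restrictScalars.{w} f).obj M))
    { toFun := fun x : M => s • x
      map_add' := fun x y : M => smul_add s x y
      map_smul' := fun r (x : M) => by
        change s • f r • x = f (α r) • s • x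
        rw [← mul_smul, hs, mul_smul] }
  naturality M N θ := ModuleCat.hom_ext (LinearMap.ext fun x : M => (θ.hom.map_smul s x).symm)

end SemilinearMultiplication

/-! ## The enveloping algebra of a skew group algebra -/

section EnvSkew

universe w u v

variable (K : Type w) (A : Type u) (G : Type v) [Field K] [Ring A] [Algebra K A]
  [Group G] [MulSemiringAction G A] [SMulCommClass G K A]

namespace SkewMonoidAlgebra

/-- The inclusion `A → A # G`. -/
noncomputable def inclOne : A →ₐ[K] SkewMonoidAlgebra A G where
  __ := singleOneRingHom
  commutes' _ := rfl

/-- The coefficient at the identity, `A # G → A`. -/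
noncomputable def coeffOne : SkewMonoidAlgebra A G →ₗ[K] A where
  toFun b := b.coeff 1
  map_add' _ _ := by rw [coeff_add, Finsupp.add_apply]
  map_smul' _ _ := by rw [coeff_smul, Finsupp.smul_apply, RingHom.id_apply]

variable {K A G}

@[simp]
theorem inclOne_apply (a : A) : inclOne K A G a = single 1 a := rfl

omit [MulSemiringAction G A] [SMulCommClass G K A] in
@[simp]
theorem coeffOne_apply (b : SkewMonoidAlgebra A G) : coeffOne K A G b = b.coeff 1 := rfl

omit [Group G] [MulSemiringAction G A] in
theorem sum_single_coeff [Fintype G] (b : SkewMonoidAlgebra A G) :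
    ∑ g, single g (b.coeff g) = b := by
  conv_rhs => rw [← sum_single b]
  rw [sum_def, Finsupp.sum_fintype _ _ (fun _ => single_zero _)]

/-- This and the next identity are the two dual basis relations for A → A#G, with trace the
coefficient at 1 and bases g⁻¹ and g. -/
theorem sum_coeff_mul_single_inv [Fintype G] (b : SkewMonoidAlgebra A G) :
    ∑ g, single 1 ((b * single g⁻¹ 1).coeff 1) * single g 1 = b := by
  conv_rhs => rw [← sum_single_coeff b]
  simp

theorem sum_single_inv_mul_coeff [Fintype G] (b : SkewMonoidAlgebra A G) :
    ∑ g, single g⁻¹ 1 * single 1 ((single g 1 * b).coeff 1) = b := by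
  conv_rhs => rw [← sum_single_coeff b, ← Equiv.sum_comp (Equiv.inv G)]
  simp

end SkewMonoidAlgebra

open SkewMonoidAlgebra

/-- The inclusion `A^e → (A # G)^e`. -/
noncomputable def envIncl : Env K A →ₐ[K] Env K (SkewMonoidAlgebra A G) :=
  Algebra.TensorProduct.map (inclOne K A G) (AlgHom.op (inclOne K A G))

/-- The projection `(A # G)^e → A^e`. -/
noncomputable def envTr : Env K (SkewMonoidAlgebra A G) →ₗ[K] Env K A :=
  TensorProduct.map (coeffOne K A G) ((MulOpposite.opLinearEquiv K).toLinearMap ∘ₗ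
    coeffOne K A G ∘ₗ (MulOpposite.opLinearEquiv K).symm.toLinearMap)

/-- The automorphism `a ⊗ b ↦ g(a) ⊗ b` of `A^e`. -/
noncomputable def envActLeft (g : G) : Env K A ≃ₐ[K] Env K A :=
  Algebra.TensorProduct.congr (MulSemiringAction.toAlgEquiv K A g) AlgEquiv.refl

variable {K A G}

@[simp]
theorem envIncl_tmul (a b : A) :
    envIncl K A G (a ⊗ₜ MulOpposite.op b) = single 1 a ⊗ₜ MulOpposite.op (single 1 b) := rfl

@[simp]
theorem envTr_tmul (a b : SkewMonoidAlgebra A G) :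
    envTr K A G (a ⊗ₜ MulOpposite.op b) = a.coeff 1 ⊗ₜ MulOpposite.op (b.coeff 1) := rfl

@[simp]
theorem envActLeft_tmul (g : G) (a b : A) :
    envActLeft K A G g (a ⊗ₜ MulOpposite.op b) = (g • a) ⊗ₜ MulOpposite.op b := rfl

/-- An additive property of elements of the enveloping algebra may be checked on pure tensors. -/
theorem Env.induction {R : Type*} [Ring R] [Algebra K R] {P : Env K R → Prop}
    (x : Env K R) (h0 : P 0) (h : ∀ a b, P (a ⊗ₜ MulOpposite.op b))
    (hadd : ∀ x y, P x → P y → P (x + y)) : P x :=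
  TensorProduct.induction_on x h0 (fun a b => h a b.unop) hadd

theorem envTr_incl_mul (x : Env K A) (y : Env K (SkewMonoidAlgebra A G)) :
    envTr K A G (envIncl K A G x * y) = x * envTr K A G y := by
  induction x using Env.induction with
  | h0 => simp
  | hadd x x' hx hx' => simp [add_mul, hx, hx']
  | h a b =>
    induction y using Env.induction with
    | h0 => simp
    | hadd y y' hy hy' => rw [mul_add, map_add, map_add, hy, hy', mul_add]
    | h c d => simp [Algebra.TensorProduct.tmul_mul_tmul, ← MulOpposite.op_mul]

theorem envTr_mul_incl (y : Env K (SkewMonoidAlgebra A G)) (x : Env K A) :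
    envTr K A G (y * envIncl K A G x) = envTr K A G y * x := by
  induction x using Env.induction with
  | h0 => simp
  | hadd x x' hx hx' => simp [mul_add, hx, hx']
  | h a b =>
    induction y using Env.induction with
    | h0 => simp
    | hadd y y' hy hy' => rw [add_mul, map_add, map_add, hy, hy', add_mul]
    | h c d => simp [Algebra.TensorProduct.tmul_mul_tmul, ← MulOpposite.op_mul]

theorem conj_mul_envIncl (g : G) (x : Env K A) :
    (single g⁻¹ (1 : A) ⊗ₜ[K] MulOpposite.op (single g (1 : A))) * envIncl K A G x =
      envIncl K A G (envAct K A G g⁻¹ x) *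
        (single g⁻¹ (1 : A) ⊗ₜ[K] MulOpposite.op (single g (1 : A))) := by
  induction x using Env.induction with
  | h0 => simp
  | hadd x x' hx hx' => simp [mul_add, add_mul, hx, hx']
  | h a b =>
    rw [envAct_tmul, envIncl_tmul, envIncl_tmul]
    simp [Algebra.TensorProduct.tmul_mul_tmul, ← MulOpposite.op_mul]

/-- The trace is not symmetric: moving g⁻¹ ⊗ g from one side of y to the other costs the
automorphism g. This produces the factor `freeOut` in the action on Ext. -/
theorem envAct_envTr_conj_mul (g : G) (y : Env K (SkewMonoidAlgebra A G)) :
    envAct K A G g (envTr K A G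
        ((single g⁻¹ (1 : A) ⊗ₜ[K] MulOpposite.op (single g (1 : A))) * y)) =
      envTr K A G (y * (single g⁻¹ (1 : A) ⊗ₜ[K] MulOpposite.op (single g (1 : A)))) := by
  induction y using Env.induction with
  | h0 => simp
  | hadd x x' hx hx' => simp [mul_add, add_mul, hx, hx']
  | h a b => simp [Algebra.TensorProduct.tmul_mul_tmul, ← MulOpposite.op_mul]

theorem single_mul_envIncl (g : G) (x : Env K A) :
    (single g (1 : A) ⊗ₜ[K] (1 : (SkewMonoidAlgebra A G)ᵐᵒᵖ)) * envIncl K A G x =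
      envIncl K A G (envActLeft K A G g x) *
        (single g (1 : A) ⊗ₜ[K] (1 : (SkewMonoidAlgebra A G)ᵐᵒᵖ)) := by
  induction x using Env.induction with
  | h0 => simp
  | hadd x x' hx hx' => simp [mul_add, add_mul, hx, hx']
  | h a b => simp [Algebra.TensorProduct.tmul_mul_tmul]

theorem envTr_single_mul_mul (g : G) (y : Env K (SkewMonoidAlgebra A G)) :
    envTr K A G ((single g (1 : A) ⊗ₜ[K] (1 : (SkewMonoidAlgebra A G)ᵐᵒᵖ)) * y *
        (single g⁻¹ (1 : A) ⊗ₜ[K] (1 : (SkewMonoidAlgebra A G)ᵐᵒᵖ))) =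
      envActLeft K A G g (envTr K A G y) := by
  induction y using Env.induction with
  | h0 => simp
  | hadd x x' hx hx' => simp [mul_add, add_mul, hx, hx']
  | h a b => simp [Algebra.TensorProduct.tmul_mul_tmul]

/-- Linearity over A^e may be tested on pure tensors. The maps `α` and `f` allow for a twisted
source and a restricted target. -/
theorem smul_of_tmul {M N S : Type*} [AddCommGroup M] [Module (Env K A) M] [AddCommGroup N]
    [Ring S] [Module S N] (α : Env K A →+* Env K A) (f : Env K A →+* S) (φ : M →+ N)
    (h : ∀ a b m, φ (α (a ⊗ₜ[K] MulOpposite.op b) • m) = f (a ⊗ₜ MulOpposite.op b) • φ m)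
    (x : Env K A) (m : M) : φ (α x • m) = f x • φ m := by
  induction x using Env.induction with
  | h0 => rw [map_zero, zero_smul (Env K A) m, map_zero, map_zero, zero_smul]
  | hadd x x' hx hx' => rw [map_add, add_smul, map_add, map_add, hx, hx', add_smul]
  | h a b => exact h a b m

variable (K A G)

/-- The Frobenius extension `A^e → (A # G)^e`. -/
noncomputable def envFrobenius [Fintype G] :
    FrobeniusSystem (envIncl K A G).toRingHom (G × G) where
  tr := (envTr K A G).toAddMonoidHom
  tr_left := envTr_incl_mul
  tr_right := envTr_mul_incl
  x i := single i.1⁻¹ 1 ⊗ₜ MulOpposite.op (single i.2 1)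
  y i := single i.1 1 ⊗ₜ MulOpposite.op (single i.2⁻¹ 1)
  sum_left s := by
    change ∑ i : G × G, envIncl K A G (envTr K A G (s * _)) * _ = s
    induction s using Env.induction with
    | h0 => simp
    | hadd x x' hx hx' =>
      simp only [add_mul, map_add, Finset.sum_add_distrib]
      rw [hx, hx']
    | h a b =>
      -- The double sum factors into one sum per tensor factor. Multiplication is reversed in the
      -- second factor, so it needs the other dual basis relation of A#G.
      simp only [Algebra.TensorProduct.tmul_mul_tmul, ← MulOpposite.op_mul, envTr_tmul,
        envIncl_tmul]
      rw [Fintype.sum_prod_type]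
      simp only
      simp_rw [← TensorProduct.tmul_sum, ← Finset.op_sum, sum_single_inv_mul_coeff]
      rw [← TensorProduct.sum_tmul, sum_coeff_mul_single_inv]
  sum_right s := by
    change ∑ i : G × G, _ * envIncl K A G (envTr K A G (_ * s)) = s
    induction s using Env.induction with
    | h0 => simp
    | hadd x x' hx hx' =>
      simp only [mul_add, map_add, Finset.sum_add_distrib]
      rw [hx, hx']
    | h a b =>
      simp only [Algebra.TensorProduct.tmul_mul_tmul, ← MulOpposite.op_mul, envTr_tmul,
        envIncl_tmul]
      rw [Fintype.sum_prod_type]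
      simp only
      simp_rw [← TensorProduct.tmul_sum, ← Finset.op_sum, sum_coeff_mul_single_inv]
      rw [← TensorProduct.sum_tmul, sum_single_inv_mul_coeff]

end EnvSkew

/-! ## Comparison of the `Ext`-groups over `A^e` and over `(A # G)^e` -/

section Transport

universe w u₁ u₂

variable {R : Type u₁} {S : Type u₂} [Ring R] [Ring S] [Small.{w} R] [Small.{w} S]

/-- The twist by `α` of the restriction to `R` of an extension class over `S`, when `α` is induced
by an element `s` of `S`. -/
theorem bimap_map_restrictScalars (f : R →+* S) (α : R →+* R) (s : S)
    (hs : ∀ r, s * f r = f (α r) * s) {n : ℕ} {X Y : ModuleCat.{w} S} (e : Ext.{w} X Y n)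
    {M M' N N' : ModuleCat.{w} R}
    {i : M ⟶ (ModuleCat.restrictScalars.{w} f).obj X}
    {q : (ModuleCat.restrictScalars.{w} f).obj Y ⟶ N}
    {j : M' ⟶ (ModuleCat.restrictScalars.{w} α).obj M}
    {p : (ModuleCat.restrictScalars.{w} α).obj N ⟶ N'}
    {i' : M' ⟶ (ModuleCat.restrictScalars.{w} f).obj X}
    {q' : (ModuleCat.restrictScalars.{w} f).obj Y ⟶ N'}
    (hi : i' ≫ (smulNatTrans f α s hs).app X = j ≫ (ModuleCat.restrictScalars.{w} α).map i)
    (hq : (smulNatTrans f α s hs).app Y ≫ (ModuleCat.restrictScalars.{w} α).map q ≫ p = q') :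
    Ext.bimap j ((Ext.bimap i (e.mapExactFunctor (ModuleCat.restrictScalars.{w} f)) q).mapExactFunctor
        (ModuleCat.restrictScalars.{w} α)) p =
      Ext.bimap i' (e.mapExactFunctor (ModuleCat.restrictScalars.{w} f)) q' := by
  have h := Ext.bimap_mapExactFunctor_app (smulNatTrans f α s hs) e i'
    ((ModuleCat.restrictScalars.{w} α).map q ≫ p)
  rw [hq, hi, Ext.mapExactFunctor_functor_comp] at h
  rw [h, Ext.mapExactFunctor_bimap, Ext.bimap_bimap]

end Transport

/-- The universe lift of a ring, as a module over itself. -/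
def uliftFreeEquiv.{u, v} (R : Type u) [Ring R] :
    R ≃ₗ[R] (ModuleCat.uliftFunctor.{v, u} R).obj (ModuleCat.of R R) :=
  ULift.moduleEquiv.symm

/-! ### The A^e-module decomposition of A#G and the components of its Ext-groups -/

section ExtSkew

universe w u v

open SkewMonoidAlgebra

section

variable {A : Type u} {G : Type v} [Ring A] [Group G] [MulSemiringAction G A]

theorem single_one_mul_mul (a b c : A) :
    single (1 : G) (a * (b * c)) = single 1 a * (single 1 b * single 1 c) := by
  simp

theorem single_inv_mul_mul (g : G) (a : A) :
    single g⁻¹ (1 : A) * (single (1 : G) a * single g (1 : A)) = single 1 (g⁻¹ • a) := by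
  simp

theorem coeff_one_mul_mul (a c : A) (b : SkewMonoidAlgebra A G) :
    (single (1 : G) a * (b * single (1 : G) c)).coeff 1 = a * (b.coeff 1 * c) := by
  simp

variable (A G) in
/-- The map `A → A # G`, `a ↦ g⁻¹ a`. -/
noncomputable def singleInvMulHom (g : G) : A →+ SkewMonoidAlgebra A G :=
  (AddMonoidHom.mulLeft (single g⁻¹ (1 : A))).comp (singleAddHom (1 : G))

theorem singleInvMulHom_apply (g : G) (a : A) :
    singleInvMulHom A G g a = single g⁻¹ 1 * single 1 a := rfl

theorem singleInvMulHom_mul_mul (g : G) (a b c : A) :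
    singleInvMulHom A G g ((g • a) * (b * c)) =
      single 1 a * (singleInvMulHom A G g b * single 1 c) := by
  simp [singleInvMulHom_apply]

theorem single_mul_singleInvMulHom_mul (g : G) (a : A) :
    single g (1 : A) * (singleInvMulHom A G g a * 1) = single 1 a := by
  simp [singleInvMulHom_apply]

theorem coeff_one_singleInvMulHom {g : G} (hg : g ≠ 1) (a : A) :
    (singleInvMulHom A G g⁻¹ a).coeff 1 = 0 := by
  simp [singleInvMulHom_apply, coeff_single, hg]

omit [MulSemiringAction G A] in
theorem coeff_single_one (a : A) : (single (1 : G) a).coeff 1 = a := by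
  simp [coeff_single]

theorem sum_singleInvMulHom_coeff [Fintype G] (b : SkewMonoidAlgebra A G) :
    ∑ g, singleInvMulHom A G g ((single g 1 * (b * 1)).coeff 1) = b := by
  simp_rw [mul_one]
  exact sum_single_inv_mul_coeff b

end

variable (K : Type w) (A : Type u) (G : Type v) [Field K] [Ring A] [Algebra K A]
  [Group G] [MulSemiringAction G A] [SMulCommClass G K A]

/-- Restriction of modules from `(A # G)^e` to `A^e`. -/
noncomputable abbrev envRes : ModuleCat.{max u v} (Env K (SkewMonoidAlgebra A G)) ⥤
    ModuleCat.{max u v} (Env K A) :=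
  ModuleCat.restrictScalars.{max u v} (envIncl K A G).toRingHom

/-- The universe lift of `A^e`-modules. -/
noncomputable abbrev envLift : ModuleCat.{u} (Env K A) ⥤ ModuleCat.{max u v} (Env K A) :=
  ModuleCat.uliftFunctor.{v, u} (Env K A)

/-- The twist of (universe lifted) `A^e`-modules by an endomorphism of `A^e`. -/
noncomputable abbrev envTwist (α : Env K A →+* Env K A) :
    ModuleCat.{max u v} (Env K A) ⥤ ModuleCat.{max u v} (Env K A) :=
  ModuleCat.restrictScalars.{max u v} α

/-- The inclusion `A → A # G` of `A^e`-modules. -/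
noncomputable def selfIncl :
    (envLift.{w, u, v} K A).obj (envSelf K A) ⟶
      (envRes K A G).obj (envSelf K (SkewMonoidAlgebra A G)) :=
  ModuleCat.ofHom (X := (envLift.{w, u, v} K A).obj (envSelf K A))
    (Y := (envRes K A G).obj (envSelf K (SkewMonoidAlgebra A G)))
    { toFun := fun a => single (1 : G) (show A from a.down)
      map_add' := fun a b => single_add (1 : G) (show A from a.down) (show A from b.down)
      map_smul' := fun x a => smul_of_tmul (M := envSelf K A)
        (N := envSelf K (SkewMonoidAlgebra A G)) (RingHom.id _) (envIncl K A G).toRingHom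
        (singleAddHom (k := A) (1 : G)) (fun b c m => single_one_mul_mul b m c) x a.down }

/-- The projection `A # G → A` of `A^e`-modules. -/
noncomputable def selfProj :
    (envRes K A G).obj (envSelf K (SkewMonoidAlgebra A G)) ⟶
      (envLift.{w, u, v} K A).obj (envSelf K A) :=
  ModuleCat.ofHom (X := (envRes K A G).obj (envSelf K (SkewMonoidAlgebra A G)))
    (Y := (envLift.{w, u, v} K A).obj (envSelf K A))
    { toFun := fun b => ULift.up (coeffOne K A G b)
      map_add' := fun b c => congrArg ULift.up (map_add (coeffOne K A G) b c)
      map_smul' := fun x b => congrArg ULift.up <| by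
        let _ : Module (Env K A) (SkewMonoidAlgebra A G) :=
          ((envRes K A G).obj (envSelf K (SkewMonoidAlgebra A G))).isModule
        exact smul_of_tmul (M := SkewMonoidAlgebra A G)
          (N := envSelf K A) (RingHom.id (Env K A)) (RingHom.id (Env K A))
          (coeffOne K A G).toAddMonoidHom (fun c d m => coeff_one_mul_mul c d m) x b }

/-- The map `A → A # G`, `a ↦ g⁻¹ a`, which is linear for the twist of `A` by
`a ⊗ b ↦ g(a) ⊗ b`. -/
noncomputable def selfTwistIncl (g : G) :
    (envTwist.{w, u, v} K A (envActLeft K A G g).toRingEquiv.toRingHom).obj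
      ((envLift.{w, u, v} K A).obj (envSelf K A)) ⟶
      (envRes K A G).obj (envSelf K (SkewMonoidAlgebra A G)) :=
  ModuleCat.ofHom
    (X := (envTwist.{w, u, v} K A (envActLeft K A G g).toRingEquiv.toRingHom).obj
      ((envLift.{w, u, v} K A).obj (envSelf K A)))
    (Y := (envRes K A G).obj (envSelf K (SkewMonoidAlgebra A G)))
    { toFun := fun a => singleInvMulHom A G g (show A from ULift.down a)
      map_add' := fun a b => map_add (singleInvMulHom A G g) (show A from ULift.down a)
        (show A from ULift.down b)
      map_smul' := fun x a => smul_of_tmul (M := envSelf K A)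
          (N := envSelf K (SkewMonoidAlgebra A G))
          (envActLeft K A G g).toRingEquiv.toRingHom (envIncl K A G).toRingHom
          (singleInvMulHom A G g) (fun b c m => singleInvMulHom_mul_mul g b m c) x
          (ULift.down a) }

/-- `A^e → A^e`, `x ↦ g(x)` as a map to the twist, where `g(a ⊗ b) = g(a) ⊗ b`. -/
noncomputable def freeToTwist (g : G) :
    (envLift.{w, u, v} K A).obj (envFree K A) ⟶
    (envTwist.{w, u, v} K A (envActLeft K A G g).toRingEquiv.toRingHom).obj
      ((envLift.{w, u, v} K A).obj (envFree K A)) :=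
  ModuleCat.ofHom
    (X := (envLift.{w, u, v} K A).obj (envFree K A))
    (Y := (envTwist.{w, u, v} K A (envActLeft K A G g).toRingEquiv.toRingHom).obj
      ((envLift.{w, u, v} K A).obj (envFree K A)))
    { toFun := fun x => ULift.up (envActLeft K A G g x.down)
      map_add' := fun _ _ => congrArg ULift.up (map_add (envActLeft K A G g) _ _)
      map_smul' := fun _ _ => congrArg ULift.up (map_mul (envActLeft K A G g) _ _) }

instance (g : G) : IsIso (freeToTwist.{w, u, v} K A G g) := by
  refine (ConcreteCategory.isIso_iff_bijective _).2 ⟨fun x y h => ?_, fun x => ?_⟩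
  · exact ULift.down_injective ((envActLeft K A G g).injective (congrArg ULift.down h))
  · exact ⟨ULift.up ((envActLeft K A G g).symm (ULift.down x)),
      congrArg ULift.up ((envActLeft K A G g).apply_symm_apply _)⟩

variable [Fintype G]

/-- The projection `(A # G)^e → A^e` of `A^e`-modules. -/
noncomputable def freeProj :
    (envRes K A G).obj (envFree K (SkewMonoidAlgebra A G)) ⟶
      (envLift.{w, u, v} K A).obj (envFree K A) :=
  (envFrobenius K A G).trHom (uliftFreeEquiv.{u, v} (Env K A))

variable {K A G} {m : ℕ}

/-- **Shapiro's lemma** for the extension `A^e → (A # G)^e`. -/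
theorem bijective_shapiro (X : ModuleCat.{max u v} (Env K (SkewMonoidAlgebra A G))) :
    Function.Bijective (fun e : Ext.{max u v} X (envFree K (SkewMonoidAlgebra A G)) m =>
      Ext.bimap (𝟙 _) (e.mapExactFunctor (envRes K A G)) (freeProj K A G)) :=
  (envFrobenius K A G).bijective_ext _ X m

/-- A#G lives in a larger universe than A, so the comparison takes place among lifted modules. The
lift changes no Ext-group, being exact, fully faithful and projective preserving. -/
theorem bijective_lift :
    Function.Bijective (fun e : Ext.{u} (envSelf K A) (envFree K A) m =>
      e.mapExactFunctor (envLift.{w, u, v} K A)) :=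
  Functor.mapExt_bijective_of_preservesProjectiveObjects _ _ _ _

theorem bijective_twist (α : Env K A ≃+* Env K A) (X Y : ModuleCat.{max u v} (Env K A)) :
    Function.Bijective (fun e : Ext.{max u v} X Y m =>
      e.mapExactFunctor (envTwist.{w, u, v} K A α.toRingHom)) := by
  have : (envTwist.{w, u, v} K A α.toRingHom).IsEquivalence :=
    ModuleCat.restrictScalars_isEquivalence_of_ringEquiv α
  exact Functor.mapExt_bijective_of_preservesProjectiveObjects
    (envTwist.{w, u, v} K A α.toRingHom) X Y m


/-! ### The comparison map on Ext: linearity, conjugation and components -/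

/-- The comparison `Ext_{(A # G)^e}(A # G, (A # G)^e) → Ext_{A^e}(A, A^e)`, before descending
universes. -/
noncomputable def extRes (e : Ext.{max u v} (envSelf K (SkewMonoidAlgebra A G))
    (envFree K (SkewMonoidAlgebra A G)) m) :
    Ext.{max u v} ((envLift.{w, u, v} K A).obj (envSelf K A))
      ((envLift.{w, u, v} K A).obj (envFree K A)) m :=
  Ext.bimap (selfIncl K A G) (e.mapExactFunctor (envRes K A G)) (freeProj K A G)

/-- The comparison `Ext_{(A # G)^e}(A # G, (A # G)^e) → Ext_{A^e}(A, A^e)`: restriction to `A^e`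
followed by `A → A # G` and `(A # G)^e → A^e`. -/
noncomputable def extTr (e : Ext.{max u v} (envSelf K (SkewMonoidAlgebra A G))
    (envFree K (SkewMonoidAlgebra A G)) m) : Ext.{u} (envSelf K A) (envFree K A) m :=
  (Equiv.ofBijective _ (bijective_lift.{w, u, v} (K := K) (A := A) (m := m))).symm (extRes e)

section

variable (e e' : Ext.{max u v} (envSelf K (SkewMonoidAlgebra A G))
  (envFree K (SkewMonoidAlgebra A G)) m)

theorem map_extTr :
    (extTr e).mapExactFunctor (envLift.{w, u, v} K A) = extRes e :=
  (Equiv.ofBijective _ (bijective_lift.{w, u, v} (K := K) (A := A) (m := m))).apply_symm_apply _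

/-- Identities for `extTr` are checked after the universe lift, where it is the explicit composite
`extRes`. -/
theorem extTr_eq_iff (z : Ext.{u} (envSelf K A) (envFree K A) m) :
    extTr e = z ↔ extRes e = z.mapExactFunctor (envLift.{w, u, v} K A) := by
  rw [← map_extTr]
  exact (bijective_lift.{w, u, v} (K := K) (A := A) (m := m)).1.eq_iff.symm

theorem extRes_add : extRes (e + e') = extRes e + extRes e' := by
  unfold extRes
  rw [Ext.mapExactFunctor_add, Ext.bimap_add]

theorem extTr_add : extTr (e + e') = extTr e + extTr e' := by
  rw [extTr_eq_iff, extRes_add, ← map_extTr, ← map_extTr, Ext.mapExactFunctor_add]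

theorem extRes_bimap_envRight (x : Env K (SkewMonoidAlgebra A G)) :
    extRes (Ext.bimap (𝟙 _) e (envRight K _ x)) =
      Ext.bimap (selfIncl K A G) (e.mapExactFunctor (envRes K A G))
        ((envRes K A G).map (envRight K (SkewMonoidAlgebra A G) x) ≫ freeProj K A G) := by
  unfold extRes
  rw [Ext.mapExactFunctor_bimap, Ext.bimap_bimap, CategoryTheory.Functor.map_id, Category.comp_id]

theorem extTr_bimap_envRight (x : Env K A) :
    extTr (Ext.bimap (𝟙 _) e (envRight K _ (envIncl K A G x))) =
      Ext.bimap (𝟙 _) (extTr e) (envRight K A x) := by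
  have h : (envRes K A G).map (envRight K (SkewMonoidAlgebra A G) (envIncl K A G x)) ≫
      freeProj K A G = freeProj K A G ≫ (envLift.{w, u, v} K A).map (envRight K A x) :=
    ModuleCat.hom_ext (LinearMap.ext fun y : Env K (SkewMonoidAlgebra A G) =>
      congrArg ULift.up (envTr_mul_incl y x))
  rw [extTr_eq_iff, extRes_bimap_envRight, h, Ext.mapExactFunctor_bimap, map_extTr, extRes,
    Ext.bimap_bimap, CategoryTheory.Functor.map_id, Category.id_comp]

/-- The twist of universe lifted modules is the universe lift of the twist. -/
noncomputable def liftTwist (K : Type w) (A : Type u) [Field K] [Ring A] [Algebra K A]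
    (α : Env K A →+* Env K A) :
    envLift.{w, u, v} K A ⋙ envTwist.{w, u, v} K A α ⟶
      ModuleCat.restrictScalars.{u} α ⋙ envLift.{w, u, v} K A where
  app M := ModuleCat.ofHom
    (X := (envLift.{w, u, v} K A ⋙ envTwist.{w, u, v} K A α).obj M)
    (Y := (ModuleCat.restrictScalars.{u} α ⋙ envLift.{w, u, v} K A).obj M)
    { toFun := fun x => x
      map_add' := fun _ _ => rfl
      map_smul' := fun _ _ => rfl }

/-- `A → A`, `a ↦ g⁻¹(a)`, as a morphism from the universe lift of `A` to its twist by `g`. -/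
noncomputable def liftSelfIn (K : Type w) (A : Type u) (G : Type v) [Field K] [Ring A] [Algebra K A]
    [Group G] [MulSemiringAction G A] [SMulCommClass G K A] (g : G) :
    (envLift.{w, u, v} K A).obj (envSelf K A) ⟶
      (envTwist.{w, u, v} K A (envAct K A G g⁻¹).toRingHom).obj
        ((envLift.{w, u, v} K A).obj (envSelf K A)) :=
  ModuleCat.ofHom (X := (envLift.{w, u, v} K A).obj (envSelf K A))
    (Y := (envTwist.{w, u, v} K A (envAct K A G g⁻¹).toRingHom).obj
        ((envLift.{w, u, v} K A).obj (envSelf K A)))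
    { toFun := fun a => ULift.up (g⁻¹ • (show A from a.down) : A)
      map_add' := fun a b => congrArg ULift.up (smul_add g⁻¹ (show A from a.down) (show A from b.down))
      map_smul' := fun x a => congrArg ULift.up (smul_envSelf K A G g⁻¹ x a.down) }

/-- Multiplication by g⁻¹ ⊗ g is a natural map from restricted B^e-modules to their twists, so it
can be slid past the restricted class. On A ⊂ A#G it is a ↦ g⁻¹(a), and against the trace it becomes
x ↦ g(x): the two maps defining `extAct`. -/
theorem extTr_conj (g : G) :
    extTr (Ext.bimap (𝟙 _) e
      (envRight K _ (single g⁻¹ (1 : A) ⊗ₜ[K] MulOpposite.op (single g (1 : A))))) =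
      ExtEnv.extAct g (extTr e) := by
  have hl : Ext.bimap ((envLift.{w, u, v} K A).map (selfIn K A G g))
      (((extTr e).mapExactFunctor (twist K A G g)).mapExactFunctor (envLift.{w, u, v} K A))
      ((envLift.{w, u, v} K A).map (freeOut K A G g)) =
      Ext.bimap (liftSelfIn K A G g)
        ((extRes e).mapExactFunctor (envTwist.{w, u, v} K A (envAct K A G g⁻¹).toRingHom))
        ((liftTwist K A (envAct K A G g⁻¹).toRingHom).app (envFree K A) ≫
          (envLift.{w, u, v} K A).map (freeOut K A G g)) := by
    have h := Ext.bimap_mapExactFunctor_app (liftTwist K A (envAct K A G g⁻¹).toRingHom) (extTr e)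
      (liftSelfIn K A G g) ((envLift.{w, u, v} K A).map (freeOut K A G g))
    rw [Ext.mapExactFunctor_functor_comp, Ext.mapExactFunctor_functor_comp, map_extTr] at h
    exact h.symm
  have hr : ExtEnv.extAct g (extTr e) = Ext.bimap (selfIn K A G g)
      ((extTr e).mapExactFunctor (twist K A G g)) (freeOut K A G g) := rfl
  rw [extTr_eq_iff, extRes_bimap_envRight, hr, Ext.mapExactFunctor_bimap, hl, extRes]
  refine (bimap_map_restrictScalars (envIncl K A G).toRingHom (envAct K A G g⁻¹).toRingHom
    _ (conj_mul_envIncl g) e ?_ ?_).symm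
  · refine ModuleCat.hom_ext (LinearMap.ext fun a => ?_)
    exact single_inv_mul_mul g (show A from a.down)
  · exact ModuleCat.hom_ext (LinearMap.ext fun y : Env K (SkewMonoidAlgebra A G) =>
      congrArg ULift.up (envAct_envTr_conj_mul g y))

/-- Shapiro's map determines the twists of all components of an extension class. -/
theorem twist_extRes (g : G) :
    (extRes (Ext.bimap (𝟙 _) e (envRight K _ (single g⁻¹ (1 : A) ⊗ₜ[K] 1)))).mapExactFunctor
        (envTwist.{w, u, v} K A (envActLeft K A G g).toRingEquiv.toRingHom) =
      Ext.bimap (selfTwistIncl K A G g)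
        (Ext.bimap (𝟙 _) (e.mapExactFunctor (envRes K A G)) (freeProj K A G))
        (freeToTwist K A G g) := by
  rw [extRes_bimap_envRight, Ext.bimap_bimap, Category.comp_id]
  -- Identities are inserted on both sides to match the general transport lemma, now applied to
  -- multiplication by g ⊗ 1.
  refine (Ext.bimap_id _).symm.trans ?_
  refine bimap_map_restrictScalars (envIncl K A G).toRingHom
    (envActLeft K A G g).toRingEquiv.toRingHom _ (single_mul_envIncl g) e ?_ ?_
  · refine ModuleCat.hom_ext (LinearMap.ext fun a => ?_)
    exact single_mul_singleInvMulHom_mul g (show A from ULift.down a)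
  · refine ModuleCat.hom_ext (LinearMap.ext fun y : Env K (SkewMonoidAlgebra A G) => ?_)
    exact congrArg ULift.up (envTr_single_mul_mul g y)

/-- The component of degree `g⁻¹` of `A # G`. -/
noncomputable def selfTwistProj (K : Type w) (A : Type u) (G : Type v) [Field K] [Ring A]
    [Algebra K A] [Group G] [MulSemiringAction G A] [SMulCommClass G K A] (g : G) :
    (envRes K A G).obj (envSelf K (SkewMonoidAlgebra A G)) ⟶
      (envTwist.{w, u, v} K A (envActLeft K A G g).toRingEquiv.toRingHom).obj
        ((envLift.{w, u, v} K A).obj (envSelf K A)) :=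
  (smulNatTrans (envIncl K A G).toRingHom (envActLeft K A G g).toRingEquiv.toRingHom _
    (single_mul_envIncl g)).app (envSelf K (SkewMonoidAlgebra A G)) ≫
    (envTwist.{w, u, v} K A (envActLeft K A G g).toRingEquiv.toRingHom).map (selfProj K A G)

/-- Over A^e, A#G is the sum of the g⁻¹A; this writes the identity as the sum of the projections
onto them. -/
theorem sum_selfTwistProj_comp (K : Type w) (A : Type u) (G : Type v) [Field K] [Ring A]
    [Algebra K A] [Group G] [MulSemiringAction G A] [SMulCommClass G K A] [Fintype G] :
    ∑ g, selfTwistProj K A G g ≫ selfTwistIncl K A G g = 𝟙 _ := by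
  refine ModuleCat.hom_ext (LinearMap.ext fun b => ?_)
  rw [ModuleCat.hom_sum, LinearMap.sum_apply]
  exact sum_singleInvMulHom_coeff b

/-- By `twist_extRes` the hypothesis kills the Shapiro image of e on each summand g⁻¹A, hence on all
of A#G. Shapiro's map is injective. -/
theorem eq_zero_of_extTr_eq_zero
    (h : ∀ g : G, extTr (Ext.bimap (𝟙 _) e (envRight K _ (single g (1 : A) ⊗ₜ[K] 1))) = 0) :
    e = 0 := by
  refine (bijective_shapiro _).1 ?_
  simp only
  rw [Ext.mapExactFunctor_zero, Ext.bimap_zero]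
  have h' : ∀ g : G, Ext.bimap (selfTwistIncl K A G g)
      (Ext.bimap (𝟙 _) (e.mapExactFunctor (envRes K A G)) (freeProj K A G)) (𝟙 _) = 0 := by
    intro g
    have h₁ := (extTr_eq_iff _ _).1 (h g⁻¹)
    rw [Ext.mapExactFunctor_zero] at h₁
    have h₂ := congrArg (fun z => Ext.bimap (𝟙 _) z (inv (freeToTwist K A G g)))
      (twist_extRes e g)
    simp only [h₁, Ext.mapExactFunctor_zero, Ext.bimap_zero] at h₂
    rw [Ext.bimap_bimap (𝟙 _), IsIso.hom_inv_id, Category.id_comp] at h₂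
    exact h₂.symm
  generalize Ext.bimap (𝟙 _) (e.mapExactFunctor (envRes K A G)) (freeProj K A G) = z at h' ⊢
  rw [← Ext.bimap_id z, ← sum_selfTwistProj_comp, Ext.sum_bimap]
  refine Finset.sum_eq_zero fun g _ => ?_
  have h₁ := congrArg (fun z => Ext.bimap (selfTwistProj K A G g) z (𝟙 _)) (h' g)
  simp only [Ext.bimap_zero] at h₁
  rwa [Ext.bimap_bimap, Category.comp_id] at h₁

/-- Extend z by zero along the projection A#G → A and take the preimage under Shapiro's map. -/
theorem exists_extTr_eq (z : Ext.{u} (envSelf K A) (envFree K A) m) :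
    ∃ e : Ext.{max u v} (envSelf K (SkewMonoidAlgebra A G))
      (envFree K (SkewMonoidAlgebra A G)) m, extTr e = z ∧ ∀ g : G, g ≠ 1 →
        extTr (Ext.bimap (𝟙 _) e (envRight K _ (single g (1 : A) ⊗ₜ[K] 1))) = 0 := by
  obtain ⟨e, he⟩ := (bijective_shapiro _).2
    (Ext.bimap (selfProj K A G) (z.mapExactFunctor (envLift.{w, u, v} K A)) (𝟙 _))
  refine ⟨e, ?_, fun g hg => ?_⟩
  · have h : selfIncl K A G ≫ selfProj K A G = 𝟙 _ := by
      refine ModuleCat.hom_ext (LinearMap.ext fun a => ?_)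
      exact congrArg ULift.up (coeff_single_one (G := G) (show A from a.down))
    have h₁ := congrArg (fun z => Ext.bimap (selfIncl K A G) z (𝟙 _)) he
    simp only [Ext.bimap_bimap, Category.comp_id, h, Ext.bimap_id] at h₁
    rw [extTr_eq_iff]
    exact h₁
  · have h : selfTwistIncl K A G g⁻¹ ≫ selfProj K A G = 0 := by
      refine ModuleCat.hom_ext (LinearMap.ext fun a => ?_)
      exact congrArg ULift.up (coeff_one_singleInvMulHom hg (show A from ULift.down a))
    have h₁ := twist_extRes e g⁻¹
    simp only at he
    rw [he, Ext.bimap_bimap, h, Ext.zero_bimap, inv_inv] at h₁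
    rw [extTr_eq_iff, Ext.mapExactFunctor_zero]
    -- `twist_extRes` gives the vanishing only after twisting; twisting is an equivalence, so it can
    -- be undone.
    refine (bijective_twist (envActLeft K A G g⁻¹).toRingEquiv _ _).1 ?_
    exact h₁.trans (Ext.mapExactFunctor_zero _ _ _ _).symm

end

end ExtSkew

/-! ## The tensor algebra and the skew group algebra -/

namespace SkewMonoidAlgebra

open MulOpposite

/-- A `B`-`B`-bimodule `W`, for `B = A # G`, is induced from the `G`-compatible bimodule `V` if it
is `V ⊗ KG`, the map `φ` being the component `W → V` at the identity of `G`. -/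
structure IsInducedBimodule {A G V W : Type*} [Ring A] [Group G] [MulSemiringAction G A]
    [AddCommGroup V] [Module A V] [Module Aᵐᵒᵖ V] [DistribMulAction G V]
    [AddCommGroup W] [Module (SkewMonoidAlgebra A G) W] [Module (SkewMonoidAlgebra A G)ᵐᵒᵖ W]
    (φ : W →+ V) : Prop where
  left : ∀ (a : A) (w : W), φ (single (1 : G) a • w) = a • φ w
  right : ∀ (a : A) (w : W), φ (op (single (1 : G) a) • w) = op a • φ w
  conj : ∀ (g : G) (w : W), φ (single g (1 : A) • op (single g⁻¹ (1 : A)) • w) = g • φ w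
  eq_zero : ∀ w : W, (∀ g : G, φ (op (single g (1 : A)) • w) = 0) → w = 0
  exists_eq : ∀ v : V, ∃ w : W, φ w = v ∧ ∀ g : G, g ≠ 1 → φ (op (single g (1 : A)) • w) = 0

namespace IsInducedBimodule

variable {K A G V W : Type*} [Ring A] [Group G] [MulSemiringAction G A]
  [AddCommGroup V] [Module A V] [Module Aᵐᵒᵖ V] [DistribMulAction G V]
  [AddCommGroup W] [Module (SkewMonoidAlgebra A G) W] [Module (SkewMonoidAlgebra A G)ᵐᵒᵖ W]

section

variable {φ : W →+ V} (hφ : IsInducedBimodule (A := A) (G := G) φ)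

include hφ

theorem ext {w w' : W}
    (h : ∀ g : G, φ (op (single g (1 : A)) • w) = φ (op (single g (1 : A)) • w')) : w = w' :=
  sub_eq_zero.1 (hφ.eq_zero _ fun g => by rw [smul_sub, map_sub, h, sub_self])

/-- Move the scalar past the group element: (a g) y = (g y) · (g y)⁻¹(a), then use right
A-linearity. -/
theorem op_smul_op_smul (y g : G) (a : A) (w : W) :
    φ (op (single y (1 : A)) • op (single g a) • w) =
      op ((g * y)⁻¹ • a) • φ (op (single (g * y) (1 : A)) • w) := by
  rw [← mul_smul, ← op_mul]
  have h₂ : single g a * single y (1 : A) =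
      single (g * y) 1 * single 1 ((g * y)⁻¹ • a) := by
    simp only [single_mul_single, smul_inv_smul, mul_one, one_mul, smul_one]
  rw [h₂, op_mul, mul_smul, hφ.right]

theorem map_smul_scalar [Field K] [Algebra K A] [SMulCommClass G K A] [Module K V]
    [IsScalarTower K A V] [Module K W] [IsScalarTower K (SkewMonoidAlgebra A G) W]
    (k : K) (w : W) : φ (k • w) = k • φ w := by
  have h₁ : k • w = single (1 : G) (algebraMap K A k) • w := by
    rw [← one_smul (SkewMonoidAlgebra A G) w, ← smul_assoc, one_smul,
      ← Algebra.algebraMap_eq_smul_one]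
    rfl
  rw [h₁, hφ.left, algebraMap_smul]

end

variable [SMulCommClass (SkewMonoidAlgebra A G) (SkewMonoidAlgebra A G)ᵐᵒᵖ W]

theorem op_smul_scalar [Field K] [Algebra K A] [SMulCommClass G K A] [Module K W]
    [IsScalarTower K (SkewMonoidAlgebra A G) W]
    (b : SkewMonoidAlgebra A G) (k : K) (w : W) :
    op b • k • w = k • op b • w := by
  have h : ∀ x : W, k • x = (k • (1 : SkewMonoidAlgebra A G)) • x := fun x => by
    rw [smul_assoc, one_smul]
  rw [h, h, ← smul_comm]

variable {φ : W →+ V} (hφ : IsInducedBimodule (A := A) (G := G) φ)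

include hφ

/-- Since y = (y g) g⁻¹, the element g w y is the conjugate by g of w (y g), to which `conj`
applies. -/
theorem op_smul_single_smul (y g : G) (a : A) (w : W) :
    φ (op (single y (1 : A)) • single g a • w) = a • g • φ (op (single (y * g) (1 : A)) • w) := by
  have h₁ : single g a = single (1 : G) a * single g 1 := by simp
  have h₂ : single y (1 : A) = single (y * g) 1 * single g⁻¹ 1 := by simp
  rw [h₁, mul_smul, ← smul_comm, hφ.left, ← smul_comm, h₂, op_mul, mul_smul, hφ.conj]

variable [Field K] [Algebra K A] [SMulCommClass G K A] [Module K V] [IsScalarTower K A V]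
  [Module K W] [IsScalarTower K (SkewMonoidAlgebra A G) W]

/-- The inclusion of `V` in the induced bimodule. -/
noncomputable def section_ : V →ₗ[K] W where
  toFun v := (hφ.exists_eq v).choose
  -- The chosen lift has prescribed components, and components determine an element of W, so the
  -- choice is linear.
  map_add' v v' := hφ.ext fun g => by
    rw [smul_add, map_add]
    by_cases hg : g = 1
    · rw [hg, single_one_one, op_one, one_smul, one_smul, one_smul,
        (hφ.exists_eq _).choose_spec.1, (hφ.exists_eq _).choose_spec.1,
        (hφ.exists_eq _).choose_spec.1]
    · rw [(hφ.exists_eq _).choose_spec.2 g hg, (hφ.exists_eq _).choose_spec.2 g hg,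
        (hφ.exists_eq _).choose_spec.2 g hg, add_zero]
  map_smul' k v := hφ.ext fun g => by
    rw [RingHom.id_apply, op_smul_scalar, hφ.map_smul_scalar]
    by_cases hg : g = 1
    · rw [hg, single_one_one, op_one, one_smul, one_smul,
        (hφ.exists_eq _).choose_spec.1, (hφ.exists_eq _).choose_spec.1]
    · rw [(hφ.exists_eq _).choose_spec.2 g hg, (hφ.exists_eq _).choose_spec.2 g hg, smul_zero]

theorem apply_section (v : V) : φ (hφ.section_ (K := K) v) = v :=
  (hφ.exists_eq v).choose_spec.1

theorem apply_op_smul_section [DecidableEq G] (g : G) (v : V) :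
    φ (op (single g (1 : A)) • hφ.section_ (K := K) v) = if g = 1 then v else 0 := by
  split_ifs with hg
  · rw [hg, single_one_one, op_one, one_smul, apply_section]
  · exact (hφ.exists_eq v).choose_spec.2 g hg

theorem section_smul (a : A) (v : V) :
    hφ.section_ (K := K) (a • v) = single (1 : G) a • hφ.section_ (K := K) v := by
  classical
  refine hφ.ext fun g => ?_
  rw [hφ.op_smul_single_smul, mul_one, one_smul, apply_op_smul_section, apply_op_smul_section]
  split_ifs <;> simp

theorem section_op_smul (a : A) (v : V) :
    hφ.section_ (K := K) (op a • v) = op (single (1 : G) a) • hφ.section_ (K := K) v := by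
  classical
  refine hφ.ext fun g => ?_
  rw [hφ.op_smul_op_smul, one_mul, apply_op_smul_section, apply_op_smul_section]
  split_ifs with hg
  · simp [hg]
  · simp

theorem section_act (g : G) (v : V) :
    hφ.section_ (K := K) (g • v) =
      single g (1 : A) • op (single g⁻¹ (1 : A)) • hφ.section_ (K := K) v := by
  classical
  refine hφ.ext fun y => ?_
  rw [hφ.op_smul_single_smul, hφ.op_smul_op_smul, apply_op_smul_section, apply_op_smul_section]
  have h : g⁻¹ * (y * g) = 1 ↔ y = 1 := by rw [inv_mul_eq_one, eq_comm, mul_eq_right]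
  simp only [h]
  split_ifs <;> simp

/-- W is the direct sum of the translates s(V) g; the part in s(V) g is read off as φ(w g⁻¹). -/
theorem sum_section [Fintype G] (w : W) :
    ∑ g : G, op (single g (1 : A)) • hφ.section_ (K := K) (φ (op (single g⁻¹ (1 : A)) • w)) = w := by
  classical
  refine hφ.ext fun y => ?_
  rw [Finset.smul_sum, _root_.map_sum]
  simp_rw [hφ.op_smul_op_smul, apply_op_smul_section]
  rw [Finset.sum_eq_single y⁻¹]
  · simp
  · intro g _ hg
    rw [if_neg (fun h => hg (eq_inv_of_mul_eq_one_left h)), smul_zero]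
  · simp

end IsInducedBimodule

end SkewMonoidAlgebra

/-! ### Mutually inverse maps between T_A(V)#G and T_{A#G}(W) -/

namespace BimoduleTensorAlgebra

open SkewMonoidAlgebra MulOpposite

variable {K A G V W : Type*} [Field K] [Ring A] [Algebra K A] [Group G] [MulSemiringAction G A]
  [SMulCommClass G K A] [AddCommGroup V] [Module K V] [Module A V] [Module Aᵐᵒᵖ V]
  [IsScalarTower K A V] [DistribMulAction G V]
  [AddCommGroup W] [Module K W] [Module (SkewMonoidAlgebra A G) W]
  [Module (SkewMonoidAlgebra A G)ᵐᵒᵖ W] [IsScalarTower K (SkewMonoidAlgebra A G) W]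
  [SMulCommClass (SkewMonoidAlgebra A G) (SkewMonoidAlgebra A G)ᵐᵒᵖ W]
  {φ : W →+ V} (hφ : IsInducedBimodule (A := A) (G := G) φ)

/-- The comparison map `T_A(V) → T_{A # G}(W)`. -/
noncomputable def ofTensor :
    BimoduleTensorAlgebra K A V →ₐ[K] BimoduleTensorAlgebra K (SkewMonoidAlgebra A G) W :=
  lift ((incl K (SkewMonoidAlgebra A G) W).comp (inclOne K A G))
    (ι K (SkewMonoidAlgebra A G) W ∘ₗ hφ.section_)
    (fun a v => by simp [hφ.section_smul, ι_smul])
    (fun v a => by simp [hφ.section_op_smul, ι_op_smul])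

@[simp]
theorem ofTensor_incl (a : A) :
    ofTensor hφ (incl K A V a) = incl K (SkewMonoidAlgebra A G) W (single 1 a) :=
  lift_incl _ _ _ _ a

@[simp]
theorem ofTensor_ι (v : V) :
    ofTensor hφ (ι K A V v) = ι K (SkewMonoidAlgebra A G) W (hφ.section_ (K := K) v) :=
  lift_ι _ _ _ _ v

/-- The map from an induced bimodule to `T_A(V) # G`. -/
noncomputable def skewι [Finite G] :
    W →ₗ[K] SkewMonoidAlgebra (BimoduleTensorAlgebra K A V) G where
  -- The coefficient at g is forced by the decomposition w = ∑ s(φ(w g⁻¹)) g.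
  toFun w := ⟨Finsupp.equivFunOnFinite.symm
    fun g => ι K A V (φ (op (single g⁻¹ (1 : A)) • w))⟩
  map_add' w w' := by
    ext g
    simp [coeff_add]
  map_smul' k w := by
    ext g
    simp [coeff_smul, IsInducedBimodule.op_smul_scalar, hφ.map_smul_scalar]

@[simp]
theorem coeff_skewι [Finite G] (w : W) (g : G) :
    (skewι (K := K) hφ w).coeff g = ι K A V (φ (op (single g⁻¹ (1 : A)) • w)) := rfl

variable [GCompatibleBimodule G A V]

@[simp]
theorem smul_incl (g : G) (a : A) : g • incl K A V a = incl K A V (g • a) :=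
  act_incl K A V G g a

@[simp]
theorem smul_ι (g : G) (v : V) : g • ι K A V v = ι K A V (g • v) :=
  act_ι K A V G g v

variable (K A G V) in
/-- The inclusion `A # G → T_A(V) # G`. -/
noncomputable def skewIncl :
    SkewMonoidAlgebra A G →ₐ[K] SkewMonoidAlgebra (BimoduleTensorAlgebra K A V) G :=
  liftNCAlgHom ((inclOne K _ G).comp (incl K A V)) (of _ G) (by simp)

@[simp]
theorem skewIncl_single (g : G) (a : A) :
    skewIncl K A G V (single g a) = single g (incl K A V a) := by
  refine (liftNC_single _ _ _ _).trans ?_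
  simp

section

variable [Finite G]

theorem skewι_smul (b : SkewMonoidAlgebra A G) (w : W) :
    skewι (K := K) hφ (b • w) = skewIncl K A G V b * skewι (K := K) hφ w := by
  induction b with
  | single g a =>
    ext y
    simp [hφ.op_smul_single_smul, ι_smul]
  | add b c hb hc => rw [add_smul, map_add, hb, hc, map_add, add_mul]

theorem skewι_op_smul (w : W) (b : SkewMonoidAlgebra A G) :
    skewι (K := K) hφ (op b • w) = skewι (K := K) hφ w * skewIncl K A G V b := by
  induction b with
  | single g a =>
    ext y
    simp [hφ.op_smul_op_smul, ← ι_op_smul, -op_smul]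
  | add b c hb hc => rw [MulOpposite.op_add, add_smul, map_add, hb, hc, map_add, mul_add]

/-- The comparison map `T_{A # G}(W) → T_A(V) # G`. -/
noncomputable def toSkew :
    BimoduleTensorAlgebra K (SkewMonoidAlgebra A G) W →ₐ[K]
      SkewMonoidAlgebra (BimoduleTensorAlgebra K A V) G :=
  lift (skewIncl K A G V) (skewι hφ) (skewι_smul hφ) (skewι_op_smul hφ)

end

/-- The commutation relation needed to extend `ofTensor` to the skew group algebra. Conjugation by g
is an algebra map, so it suffices to compare it with the action of g on A and on V, where it is
`section_act`. -/
theorem ofTensor_smul_mul (g : G) (x : BimoduleTensorAlgebra K A V) :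
    ofTensor hφ (g • x) * incl K _ W (single g (1 : A)) =
      incl K _ W (single g (1 : A)) * ofTensor hφ x := by
  have hg : incl K _ W (single g (1 : A)) * incl K _ W (single g⁻¹ (1 : A)) = 1 := by
    rw [← map_mul]; simp
  have hg' : incl K _ W (single g⁻¹ (1 : A)) * incl K _ W (single g (1 : A)) = 1 := by
    rw [← map_mul]; simp
  let c : BimoduleTensorAlgebra K (SkewMonoidAlgebra A G) W →ₐ[K]
      BimoduleTensorAlgebra K (SkewMonoidAlgebra A G) W :=
    AlgHom.ofLinearMap
      (LinearMap.mulLeft K (incl K _ W (single g (1 : A))) ∘ₗ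
        LinearMap.mulRight K (incl K _ W (single g⁻¹ (1 : A))))
      (by simp [hg])
      (fun x y => by
        simp only [LinearMap.comp_apply, LinearMap.mulLeft_apply, LinearMap.mulRight_apply]
        simp only [mul_assoc]
        rw [← mul_assoc (incl K _ W (single g⁻¹ (1 : A))), hg', one_mul])
  have hc : ∀ z, c z = incl K _ W (single g (1 : A)) * (z * incl K _ W (single g⁻¹ (1 : A))) :=
    fun _ => rfl
  have h : (ofTensor (K := K) hφ).comp (act K A V G g) = c.comp (ofTensor hφ) := by
    refine algHom_ext (fun a => ?_) (fun v => ?_)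
    · rw [AlgHom.comp_apply, AlgHom.comp_apply, act_incl, ofTensor_incl, ofTensor_incl, hc,
        ← map_mul, ← map_mul]
      simp
    · rw [AlgHom.comp_apply, AlgHom.comp_apply, act_ι, ofTensor_ι, ofTensor_ι, hc, hφ.section_act,
        ι_smul, ι_op_smul]
  have hx : ofTensor hφ (g • x) = c (ofTensor hφ x) := congrArg (fun p => p x) h
  rw [hx, hc, mul_assoc, mul_assoc, hg', mul_one]

/-- The comparison map `T_A(V) # G → T_{A # G}(W)`. -/
noncomputable def ofSkew :
    SkewMonoidAlgebra (BimoduleTensorAlgebra K A V) G →ₐ[K]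
      BimoduleTensorAlgebra K (SkewMonoidAlgebra A G) W :=
  liftNCAlgHom (ofTensor hφ) ((incl K (SkewMonoidAlgebra A G) W : _ →* _).comp (of A G))
    (fun {x g} => by simpa using ofTensor_smul_mul hφ g x)

@[simp]
theorem ofSkew_single (g : G) (x : BimoduleTensorAlgebra K A V) :
    ofSkew hφ (single g x) = ofTensor hφ x * incl K _ W (single g (1 : A)) := by
  refine (liftNC_single _ _ _ _).trans ?_
  simp

/-- If `W` is the `A # G`-bimodule induced from `V` then `T_A(V) # G ≃ T_{A # G}(W)`. -/
noncomputable def skewEquiv [Fintype G] :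
    SkewMonoidAlgebra (BimoduleTensorAlgebra K A V) G ≃ₐ[K]
      BimoduleTensorAlgebra K (SkewMonoidAlgebra A G) W :=
  AlgEquiv.ofAlgHom (ofSkew hφ) (toSkew hφ)
    (by
      refine algHom_ext (fun b => ?_) (fun w => ?_)
      · simp only [AlgHom.comp_apply, toSkew, lift_incl, AlgHom.id_apply]
        induction b with
        | single g a => rw [skewIncl_single, ofSkew_single, ofTensor_incl, ← map_mul]; simp
        | add b c hb hc => rw [map_add, map_add, hb, hc, map_add]
      · simp only [AlgHom.comp_apply, toSkew, lift_ι, AlgHom.id_apply]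
        -- On W the composite sends w to ∑ s(φ(w g⁻¹)) g, which is w again.
        conv_rhs => rw [← hφ.sum_section (K := K) w]
        rw [← sum_single_coeff (skewι hφ w), _root_.map_sum, _root_.map_sum]
        simp [ι_op_smul])
    (by
      classical
      have h : (toSkew (K := K) hφ).comp (ofTensor hφ) = inclOne K _ G := by
        refine algHom_ext (fun a => ?_) (fun v => ?_)
        · simp [toSkew]
        · ext g
          simp only [AlgHom.comp_apply, toSkew, lift_ι, ofTensor_ι, coeff_skewι,
            hφ.apply_op_smul_section, inclOne_apply, coeff_single_apply, inv_eq_one, eq_comm]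
          split_ifs <;> simp
      ext x : 1
      induction x with
      | single g x =>
        have hx : toSkew (K := K) hφ (ofTensor hφ x) = single 1 x := congrArg (fun p => p x) h
        have hg : toSkew (K := K) hφ (incl K _ W (single g (1 : A))) = single g 1 := by
          simp [toSkew]
        simp [hx, hg]
      | add x y hx hy => rw [map_add, map_add, hx, hy])

end BimoduleTensorAlgebra

/-! ## The preprojective algebra of a skew group algebra -/

section Preprojective

universe w u v

open SkewMonoidAlgebra

theorem ExtEnv.rmul_eq_bimap {K : Type w} {R : Type u} [Field K] [Ring R] [Algebra K R] {m : ℕ}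
    (e : ExtEnv K R m) (x : Env K R) :
    e.rmul x = Ext.bimap (X := envSelf K R) (𝟙 _) e (envRight K R x) :=
  (Ext.bimap_id_left (X := envSelf K R) e _).symm

variable (K : Type w) (A : Type u) (G : Type v) [Field K] [Ring A] [Algebra K A]
  [Group G] [Fintype G] [MulSemiringAction G A] [SMulCommClass G K A]

/-- The component at the identity of `G` of the `A # G`-bimodule
`Ext_{(A # G)^e}(A # G, (A # G)^e)`. -/
noncomputable def ExtEnv.skewTr (m : ℕ) : ExtEnv K (SkewMonoidAlgebra A G) m →+ ExtEnv K A m :=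
  AddMonoidHom.mk' (extTr (K := K) (A := A) (G := G) (m := m)) extTr_add

variable {K A G} {m : ℕ}

theorem ExtEnv.skewTr_rmul_envIncl (e : ExtEnv K (SkewMonoidAlgebra A G) m) (x : Env K A) :
    skewTr K A G m (e.rmul (envIncl K A G x)) = (skewTr K A G m e).rmul x := by
  rw [ExtEnv.rmul_eq_bimap, ExtEnv.rmul_eq_bimap]
  exact extTr_bimap_envRight _ x

variable (K A G m)

/-- The bimodule `Ext_{(A # G)^e}(A # G, (A # G)^e)` is induced from `Ext_{A^e}(A, A^e)`. -/
theorem ExtEnv.isInducedBimodule : IsInducedBimodule (A := A) (G := G) (skewTr K A G m) where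
  left a e := skewTr_rmul_envIncl e (1 ⊗ₜ MulOpposite.op a)
  right a e := skewTr_rmul_envIncl e (a ⊗ₜ 1)
  conj g e := by
    -- As a ⊗ b acts by e ↦ b e a, conjugation e ↦ g e g⁻¹ is right multiplication by g⁻¹ ⊗ g.
    have h : single g (1 : A) • MulOpposite.op (single g⁻¹ (1 : A)) • e =
        e.rmul (single g⁻¹ (1 : A) ⊗ₜ[K] MulOpposite.op (single g (1 : A))) := by
      rw [ExtEnv.smul_def, ExtEnv.op_smul_def, ExtEnv.rmul_mul,
        Algebra.TensorProduct.tmul_mul_tmul, one_mul, mul_one]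
    rw [h, ExtEnv.rmul_eq_bimap]
    exact extTr_conj _ g
  eq_zero e he := eq_zero_of_extTr_eq_zero _ fun g => by
    have h := he g
    rwa [ExtEnv.op_smul_def, ExtEnv.rmul_eq_bimap] at h
  exists_eq z := by
    obtain ⟨e, he, he'⟩ := exists_extTr_eq (G := G) z
    refine ⟨e, he, fun g hg => ?_⟩
    exact (congrArg (skewTr K A G m)
      (ExtEnv.rmul_eq_bimap (R := SkewMonoidAlgebra A G) e _)).trans (he' g hg)

end Preprojective

universe w u v

theorem theorem3p10 (K : Type w) (A : Type u) (G : Type v) [Field K] [Ring A] [Algebra K A]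
    [Group G] [Finite G] [MulSemiringAction G A] [SMulCommClass G K A] (n : ℕ) (hn : 2 ≤ n) :
    Nonempty (SkewMonoidAlgebra (PreprojectiveAlgebra K A n) G ≃ₐ[K]
      PreprojectiveAlgebra K (SkewMonoidAlgebra A G) n) := by
  have := Fintype.ofFinite G
  exact ⟨BimoduleTensorAlgebra.skewEquiv (ExtEnv.isInducedBimodule K A G (n - 1))⟩
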